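/- Hadamard matrices $H_t\in\mathbb R^{2^t\times 2^t}$ are defined by $H_0=1$ and $H_{t+1}=\frac1{\sqrt2}\begin{pmatrix}H_t&H_t\\H_t&-H_t\end{pmatrix}$. For $n=2^l$ and $m\le n$, a subsampled randomized Hadamard transform (SRHT) is a random matrix $S_{m,n}=\sqrt{n/m}\,B\,H_l\,D$, where $B$ and $D$ are $n\times n$ diagonal matrices whose $2n$ diagonal entries are jointly independent, those of $B$ being Bernoulli$(m/n)$ and those of $D$ being uniform on $\{\pm1\}$. Let $n=n_k=2^{l_k}$ and $m=m_k\le n_k$ $(k\in\mathbb N)$ be deterministic with $n\to\infty$, $m/\log^2 n\to\infty$ and $\limsup m/n<1$ as $k\to\infty$, and put $\gamma_n=m/n$. Let $a_n,\tilde a_n\in\mathbb R^n$ be deterministic unit vectors (which may be chosen separately for each $k$). (i) If $\|a_n\|_\infty\to0$ or $\|\tilde a_n\|_\infty\to0$, then for every sequence of SRHTs $S_{m,n}$, $$\sqrt{\frac{m}{1-\gamma_n}}\,\sqrt{\frac1{1+2(a_n^\top\tilde a_n)^2}}\,\bigl(a_n^\top S_{m,n}^\top S_{m,n}\tilde a_n-a_n^\top\tilde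 a_n\bigr)\Rightarrow N(0,1).$$ (ii) Without this delocalization condition normality can fail, even if $m/n$ converges: for every $\gamma\in[0,1)$ there are such sequences $n,m$ with $m/n\to\gamma$, unit vectors $a_n,\tilde a_n$ for which neither $\|a_n\|_\infty\to0$ nor $\|\tilde a_n\|_\infty\to0$, and SRHTs $S_{m,n}$, such that $X_n=\sqrt m\,a_n^\top S_{m,n}^\top S_{m,n}\tilde a_n$ is not asymptotically normal. That is, there are no real sequences $c_n$ and $s_n>0$ with $(X_n-c_n)/s_n\Rightarrow N(0,1)$, and there are no real sequence $c_n$ and $v\ge0$ with $X_n-c_n\Rightarrow N(0,v)$ (where $N(0,0)$ is the point mass at $0$). -/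

import Mathlib

open MeasureTheory ProbabilityTheory Filter Topology Matrix

universe u

/-- The normalized Walsh–Hadamard matrices: `H₀ = 1` and
`H_{t+1} = (1/√2) [[H_t, H_t], [H_t, -H_t]]`. -/
noncomputable def hadamardMatrix : (t : ℕ) → Matrix (Fin (2 ^ t)) (Fin (2 ^ t)) ℝ
  | 0 => 1
  | t + 1 =>
    let e : Fin (2 ^ t) ⊕ Fin (2 ^ t) ≃ Fin (2 ^ (t + 1)) :=
      finSumFinEquiv.trans (finCongr (by omega))
    (1 / √2 : ℝ) • Matrix.reindex e e
      (Matrix.fromBlocks (hadamardMatrix t) (hadamardMatrix t)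
        (hadamardMatrix t) (-hadamardMatrix t))

/-- The success probability `m / n` as an element of the unit interval. -/
noncomputable def samplingProb (m n : ℕ) (h : m ≤ n) : unitInterval :=
  ⟨(m : ℝ) / n, by positivity, div_le_one_of_le₀ (by exact_mod_cast h) (by positivity)⟩

/-- The Rademacher law: mass `1/2` at each of `1` and `-1`. -/
noncomputable def rademacherLaw : Measure ℝ :=
  bernoulliMeasure 1 (-1) ⟨1 / 2, by norm_num, by norm_num⟩

/-- `S` is a subsampled randomized Hadamard transform of size `n = 2 ^ l` with expected sample
size `m`: `S = √(n/m) B H_l D`, where `B` is diagonal with Bernoulli(`m/n`) entries, `D` is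
diagonal with Rademacher entries, and all these `2n` entries are independent. -/
def IsSRHT {Ω : Type*} [MeasurableSpace Ω] (P : Measure Ω) (l m : ℕ) (hm : m ≤ 2 ^ l)
    (S : Ω → Matrix (Fin (2 ^ l)) (Fin (2 ^ l)) ℝ) : Prop :=
  ∃ b d : Fin (2 ^ l) → Ω → ℝ,
    (∀ i, HasLaw (b i) (bernoulliMeasure 1 0 (samplingProb m (2 ^ l) hm)) P) ∧
    (∀ i, HasLaw (d i) rademacherLaw P) ∧
    iIndepFun (Sum.elim b d) P ∧
    ∀ ω, S ω = √((2 ^ l : ℕ) / (m : ℝ)) •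
      (Matrix.diagonal (fun i => b i ω) * hadamardMatrix l * Matrix.diagonal (fun i => d i ω))

/-- The bilinear form `aᵀ Sᵀ S ã`. -/
def sketchedForm {n : ℕ} (S : Matrix (Fin n) (Fin n) ℝ) (a a' : EuclideanSpace ℝ (Fin n)) : ℝ :=
  a.ofLp ⬝ᵥ ((Sᵀ * S) *ᵥ a'.ofLp)

/-- The `ℓ∞` norm of a vector. -/
noncomputable def linftyNorm {n : ℕ} (a : EuclideanSpace ℝ (Fin n)) : ℝ := ⨆ i, |a i|

/-- `ℓ∞`-delocalization of at least one of two sequences of vectors. -/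
def Delocalized {l : ℕ → ℕ} (a a' : ∀ k, EuclideanSpace ℝ (Fin (2 ^ l k))) : Prop :=
  Tendsto (fun k => linftyNorm (a k)) atTop (𝓝 0) ∨
  Tendsto (fun k => linftyNorm (a' k)) atTop (𝓝 0)

/-- The asymptotic regime for the dimensions `n_k = 2 ^ l k` and the sketch sizes `m k ≤ n_k`:
`n_k → ∞`, `m_k / log² n_k → ∞` and `limsup m_k / n_k < 1`. -/
structure SketchRegime (l m : ℕ → ℕ) : Prop where
  le : ∀ k, m k ≤ 2 ^ l k
  tendsto_dim : Tendsto (fun k => 2 ^ l k) atTop atTop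
  tendsto_size : Tendsto (fun k => (m k : ℝ) / Real.log ((2 ^ l k : ℕ) : ℝ) ^ 2) atTop atTop
  limsup_lt : limsup (fun k => (m k : ℝ) / ((2 ^ l k : ℕ) : ℝ)) atTop < 1

/-- `X` is asymptotically normal: for some deterministic centring `c` and scaling `s > 0`,
`(X_k - c_k) / s_k` converges in distribution to `N(0, 1)`, or `X_k - c_k` converges in
distribution to some, possibly degenerate, `N(0, v)`. -/
def AsymptoticallyNormal {Ω : ℕ → Type*} [∀ k, MeasurableSpace (Ω k)]
    (P : ∀ k, Measure (Ω k)) [∀ k, IsProbabilityMeasure (P k)] (X : ∀ k, Ω k → ℝ) : Prop :=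
  (∃ c s : ℕ → ℝ, (∀ k, 0 < s k) ∧
    TendstoInDistribution (fun k ω => (X k ω - c k) / s k) atTop id P (gaussianReal 0 1)) ∨
  (∃ (c : ℕ → ℝ) (v : NNReal),
    TendstoInDistribution (fun k ω => X k ω - c k) atTop id P (gaussianReal 0 v))

/-! Write u = H D a and v = H D a'. Selectors satisfy b² = b, so the form is (n/m) Σ b_i u_i v_i;
and H D is orthogonal, so Σ u_i v_i = aᵀa' for every choice of signs. Conditionally on the signs,
the centred form is therefore a weighted sum of independent centred Bernoulli variables. After
multiplication by √(m/(1-γ)) its conditional variance is exactly V = n Σ u_i² v_i²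
(`conditionalVariance`).

The conditional characteristic function is compared with exp(-t²V/2) factor by factor. The error is
a sum of |u_i v_i|³, and Khintchine's inequality bounds the sixth moments of u_i and v_i by O(n⁻³)
for all unit vectors. In total it is O(|t|³ m^(-1/2) (1-γ)^(-3/2)) (`IsSRHT.norm_charFun_sub_le`).
So, delocalized or not, the law is asymptotically a Gaussian mixture governed by V, and everything
hinges on whether V concentrates.

Expanding V in the signs gives 1 + 2(aᵀa')² - 2 Σ a_j² a'_j² plus a Rademacher chaos over quadruples
of distinct indices. If the entries of one vector are bounded by M, Parseval for H bounds the sum of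
squared chaos coefficients by M². Hence V is within 16M + 2M² of 1 + 2(aᵀa')² in L¹, and the mixture
collapses to one Gaussian.

For the failure of normality, take four columns with constant entrywise product and let a, a' each
be spread over two of them. Then V = 1 ± 1 with a fair sign. V = 0 forces the form to vanish, so it
has an atom of mass at least 1/2, which survives affine normalization and excludes nondegenerate
Gaussian limits. A point-mass limit would send the modulus of the characteristic function at 1 to 1,
but that function tends to (1 + e^(-(1-γ)))/2 < 1 (`not_asymptoticallyNormal`). -/

/-! ### Normalized Hadamard matrices -/

/-- An orthogonal matrix all of whose entries have the same absolute value. -/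
structure IsNormalizedHadamard {ι : Type*} [Fintype ι] [DecidableEq ι] (H : Matrix ι ι ℝ) :
    Prop where
  sq_apply : ∀ i j, H i j ^ 2 = 1 / (Fintype.card ι : ℝ)
  mul_transpose : H * Hᵀ = 1
  transpose_mul : Hᵀ * H = 1

/-- The identification of the index set of `H_{t+1}` with two copies of that of `H_t`. -/
def hadamardSplit (t : ℕ) : Fin (2 ^ t) ⊕ Fin (2 ^ t) ≃ Fin (2 ^ (t + 1)) :=
  finSumFinEquiv.trans (finCongr (by omega))

lemma hadamardMatrix_succ (t : ℕ) :
    hadamardMatrix (t + 1) = (1 / √2 : ℝ) • (fromBlocks (hadamardMatrix t) (hadamardMatrix t)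
      (hadamardMatrix t) (-hadamardMatrix t)).submatrix (hadamardSplit t).symm
        (hadamardSplit t).symm := rfl

lemma hadamardMatrix_succ_apply (t : ℕ) (i j : Fin (2 ^ (t + 1))) :
    hadamardMatrix (t + 1) i j = (1 / √2 : ℝ) * fromBlocks (hadamardMatrix t) (hadamardMatrix t)
      (hadamardMatrix t) (-hadamardMatrix t) ((hadamardSplit t).symm i)
        ((hadamardSplit t).symm j) := rfl

lemma hadamardMatrix_transpose (t : ℕ) : (hadamardMatrix t)ᵀ = hadamardMatrix t := by
  induction t with
  | zero => simp [hadamardMatrix]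
  | succ t ih =>
    rw [hadamardMatrix_succ, transpose_smul, transpose_submatrix, fromBlocks_transpose,
      transpose_neg, ih]

lemma hadamardMatrix_mul_self (t : ℕ) : hadamardMatrix t * hadamardMatrix t = 1 := by
  induction t with
  | zero => simp [hadamardMatrix]
  | succ t ih =>
    have h2 : (1 / √2) * (1 / √2) * 2 = (1 : ℝ) := by
      rw [div_mul_div_comm, Real.mul_self_sqrt (by norm_num)]
      norm_num
    have h3 : fromBlocks (1 + 1) (1 + -1) (1 + -1) (1 + 1) =
        (2 : ℝ) • (1 : Matrix (Fin (2 ^ t) ⊕ Fin (2 ^ t)) (Fin (2 ^ t) ⊕ Fin (2 ^ t)) ℝ) := by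
      rw [← fromBlocks_one, fromBlocks_smul]
      simp [two_smul]
    rw [hadamardMatrix_succ, smul_mul, Matrix.mul_smul, submatrix_mul_equiv, fromBlocks_multiply,
      Matrix.mul_neg, Matrix.neg_mul, Matrix.neg_mul, Matrix.mul_neg, ih, neg_neg, h3,
      submatrix_smul, Pi.smul_apply, Pi.smul_apply, submatrix_one_equiv, smul_smul, smul_smul,
      h2, one_smul]

lemma hadamardMatrix_apply_sq (t : ℕ) (i j : Fin (2 ^ t)) :
    hadamardMatrix t i j ^ 2 = 1 / 2 ^ t := by
  induction t with
  | zero =>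
    have : i = j := Subsingleton.elim (α := Fin 1) i j
    simp [hadamardMatrix, one_apply, this]
  | succ t ih =>
    have h2 : (1 / √2) ^ 2 = (1 / 2 : ℝ) := by
      rw [div_pow, Real.sq_sqrt (by norm_num)]
      norm_num
    rw [hadamardMatrix_succ_apply, mul_pow, h2]
    rcases (hadamardSplit t).symm i with x | x <;> rcases (hadamardSplit t).symm j with y | y <;>
    simp [ih, pow_succ (2 : ℝ) t, mul_comm]

lemma isNormalizedHadamard_hadamardMatrix (t : ℕ) :
    IsNormalizedHadamard (hadamardMatrix t) where
  sq_apply i j := by simpa using hadamardMatrix_apply_sq t i j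
  mul_transpose := by rw [hadamardMatrix_transpose, hadamardMatrix_mul_self]
  transpose_mul := by rw [hadamardMatrix_transpose, hadamardMatrix_mul_self]

/-- Four columns of a Walsh–Hadamard matrix whose entrywise product is constant. -/
lemma exists_hadamardMatrix_quadruple {t : ℕ} (ht : 2 ≤ t) :
    ∃ j k p q : Fin (2 ^ t), [j, k, p, q].Nodup ∧
      ∀ i, hadamardMatrix t i j * hadamardMatrix t i k * hadamardMatrix t i p *
        hadamardMatrix t i q = 1 / (2 ^ t) ^ 2 := by
  obtain ⟨t, rfl⟩ : ∃ s, t = s + 1 := ⟨t - 1, by omega⟩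
  have h2 : 2 ≤ 2 ^ t := by
    calc 2 = 2 ^ 1 := rfl
      _ ≤ 2 ^ t := Nat.pow_le_pow_right (by norm_num) (by omega)
  let e := hadamardSplit t
  let x : Fin (2 ^ t) := ⟨0, by omega⟩
  let y : Fin (2 ^ t) := ⟨1, by omega⟩
  have hxy : x ≠ y := by simp [x, y]
  -- The same two columns x, y are taken from both halves: in every row each entry occurs twice up
  -- to sign, and in the lower half the two minus signs cancel, so the product is a product of
  -- squares.
  refine ⟨e (.inl x), e (.inl y), e (.inr x), e (.inr y), by simp [hxy], fun i => ?_⟩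
  have hs : (√2 : ℝ) ^ 2 = 2 := Real.sq_sqrt (by norm_num)
  have hi : (√2)⁻¹ ^ 4 = (1 / 4 : ℝ) := by
    rw [inv_pow, show (√2 : ℝ) ^ 4 = ((√2) ^ 2) ^ 2 by ring, hs]; norm_num
  have hu (u : Fin (2 ^ t)) := hadamardMatrix_apply_sq t u x
  have hv (u : Fin (2 ^ t)) := hadamardMatrix_apply_sq t u y
  have key : ∀ u : Fin (2 ^ t), (√2)⁻¹ ^ 4 *
      (hadamardMatrix t u x ^ 2 * hadamardMatrix t u y ^ 2) = 1 / (2 ^ (t + 1)) ^ 2 := by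
    intro u
    rw [hi, hu, hv, pow_succ]
    field_simp
    ring
  simp only [hadamardMatrix_succ_apply, e, Equiv.symm_apply_apply]
  rcases (hadamardSplit t).symm i with u | u <;>
  · rw [← key u]
    simp
    ring

/-! ### Sums of products of four columns. -/

section Kernel

variable {ι : Type*} [Fintype ι] {H : Matrix ι ι ℝ}

/-- The rescaled sum over the rows of the product of four columns. -/
def fourKernel (H : Matrix ι ι ℝ) (j k p q : ι) : ℝ :=
  (Fintype.card ι : ℝ) * ∑ i, H i j * H i k * H i p * H i q

lemma fourKernel_swap_right (j k p q : ι) : fourKernel H j k p q = fourKernel H j k q p := by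
  unfold fourKernel; congr 1; exact Finset.sum_congr rfl fun i _ => by ring

lemma fourKernel_swap_mid (j k p q : ι) : fourKernel H j k p q = fourKernel H j p k q := by
  unfold fourKernel; congr 1; exact Finset.sum_congr rfl fun i _ => by ring

lemma fourKernel_swap_left (j k p q : ι) : fourKernel H j k p q = fourKernel H k j p q := by
  unfold fourKernel; congr 1; exact Finset.sum_congr rfl fun i _ => by ring

variable [DecidableEq ι]

lemma IsNormalizedHadamard.sum_col_mul_col (hH : IsNormalizedHadamard H) (p q : ι) :
    ∑ i, H i p * H i q = if p = q then 1 else 0 := by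
  have := congrFun (congrFun hH.transpose_mul p) q
  simpa [mul_apply, one_apply] using this

lemma IsNormalizedHadamard.sum_row_mul_row (hH : IsNormalizedHadamard H) (p q : ι) :
    ∑ i, H p i * H q i = if p = q then 1 else 0 := by
  have := congrFun (congrFun hH.mul_transpose p) q
  simpa [mul_apply, one_apply] using this

/-- A repeated column contributes the constant 1/N, which cancels the prefactor and leaves column
orthogonality. -/
lemma IsNormalizedHadamard.fourKernel_self (hH : IsNormalizedHadamard H) (j p q : ι) :
    fourKernel H j j p q = if p = q then 1 else 0 := by
  have : Nonempty ι := ⟨j⟩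
  have hN : (Fintype.card ι : ℝ) ≠ 0 := by simp
  rw [← hH.sum_col_mul_col p q, fourKernel, Finset.mul_sum]
  refine Finset.sum_congr rfl fun i _ => ?_
  rw [← sq, hH.sq_apply]
  field_simp

/-- Parseval: as a function of q this is N Hᵀw, where w is the entrywise product of the other three
columns, and ‖w‖² = N · N⁻³. -/
lemma IsNormalizedHadamard.sum_fourKernel_sq (hH : IsNormalizedHadamard H) (j k p : ι) :
    ∑ q, fourKernel H j k p q ^ 2 = 1 := by
  have : Nonempty ι := ⟨j⟩
  have hN : (Fintype.card ι : ℝ) ≠ 0 := by simp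
  have h1 : ∀ q, fourKernel H j k p q ^ 2 = ∑ i, ∑ i', (Fintype.card ι : ℝ) ^ 2 *
      (H i j * H i k * H i p) * (H i' j * H i' k * H i' p) * (H i q * H i' q) := by
    intro q
    rw [fourKernel, mul_pow, sq (∑ i, _), Finset.sum_mul_sum, Finset.mul_sum]
    refine Finset.sum_congr rfl fun i _ => ?_
    rw [Finset.mul_sum]
    exact Finset.sum_congr rfl fun i' _ => by ring
  simp_rw [h1]
  rw [Finset.sum_comm]
  have h2 : ∀ i, ∑ q, ∑ i', (Fintype.card ι : ℝ) ^ 2 *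
      (H i j * H i k * H i p) * (H i' j * H i' k * H i' p) * (H i q * H i' q) =
      1 / (Fintype.card ι : ℝ) := by
    intro i
    rw [Finset.sum_comm]
    simp_rw [← Finset.mul_sum, hH.sum_row_mul_row]
    simp only [mul_ite, mul_one, mul_zero, Finset.sum_ite_eq, Finset.mem_univ, if_true]
    calc _ = (Fintype.card ι : ℝ) ^ 2 * (H i j ^ 2 * H i k ^ 2 * H i p ^ 2) := by ring
      _ = _ := by
        rw [hH.sq_apply, hH.sq_apply, hH.sq_apply]
        field_simp
  rw [Finset.sum_congr rfl fun i _ => h2 i]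
  simp

end Kernel

/-! ### Rademacher chaos -/

section Signs

variable {ι : Type*} [Fintype ι]

/-- The sign attached to a Boolean. -/
def boolSign (b : Bool) : ℝ := cond b 1 (-1)

lemma boolSign_sq (b : Bool) : boolSign b ^ 2 = 1 := by cases b <;> simp [boolSign]

lemma boolSign_mul_self (b : Bool) : boolSign b * boolSign b = 1 := by
  cases b <;> simp [boolSign]

/-- The probability `1/2`. -/
noncomputable def halfProb : unitInterval := ⟨1 / 2, by norm_num, by norm_num⟩

variable (ι) in
/-- The uniform measure on Boolean vectors. -/
noncomputable def signMeasure : Measure (ι → Bool) :=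
  Measure.pi fun _ => bernoulliMeasure true false halfProb

instance : IsProbabilityMeasure (signMeasure ι) := by
  unfold signMeasure; infer_instance

lemma integral_prod_signMeasure (f : ι → Bool → ℝ) :
    ∫ ε, ∏ i, f i (ε i) ∂signMeasure ι = ∏ i, (f i true + f i false) / 2 := by
  rw [signMeasure, integral_fintype_prod_eq_prod]
  refine Finset.prod_congr rfl fun i _ => ?_
  rw [integral_bernoulliMeasure]
  simp only [halfProb, smul_eq_mul]
  ring

/-- Orthonormality of the Walsh characters: an index lying in exactly one of the two sets
contributes a factor with mean zero. -/
lemma integral_prod_boolSign_mul [DecidableEq ι] (A B : Finset ι) :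
    ∫ ε, (∏ i ∈ A, boolSign (ε i)) * ∏ i ∈ B, boolSign (ε i) ∂signMeasure ι =
      if A = B then 1 else 0 := by
  have h : ∀ ε : ι → Bool, (∏ i ∈ A, boolSign (ε i)) * ∏ i ∈ B, boolSign (ε i) =
      ∏ i, ((if i ∈ A then boolSign (ε i) else 1) * if i ∈ B then boolSign (ε i) else 1) := by
    intro ε
    rw [Finset.prod_mul_distrib]
    simp
  simp_rw [h]
  rw [integral_prod_signMeasure
    (fun i b => (if i ∈ A then boolSign b else 1) * if i ∈ B then boolSign b else 1)]
  split_ifs with hAB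
  · subst hAB
    refine Finset.prod_eq_one fun i _ => ?_
    by_cases hi : i ∈ A <;> simp [hi, boolSign]
  · obtain ⟨i, hi⟩ : ∃ i, ¬ (i ∈ A ↔ i ∈ B) := by
      by_contra hc
      push Not at hc
      exact hAB (Finset.ext hc)
    refine Finset.prod_eq_zero (Finset.mem_univ i) ?_
    by_cases hA : i ∈ A <;> by_cases hB : i ∈ B <;> simp_all [boolSign]

/-- Rademacher sums are sub-Gaussian, since each factor is cosh c ≤ exp(c²/2). -/
lemma integral_exp_sum_boolSign_le (c : ι → ℝ) :
    ∫ ε, Real.exp (∑ i, c i * boolSign (ε i)) ∂signMeasure ι ≤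
      Real.exp ((∑ i, c i ^ 2) / 2) := by
  simp_rw [Real.exp_sum]
  rw [integral_prod_signMeasure (fun i b => Real.exp (c i * boolSign b)), Finset.sum_div,
    Real.exp_sum]
  refine Finset.prod_le_prod (fun i _ => by positivity) fun i _ => ?_
  refine le_trans (le_of_eq ?_) (Real.cosh_le_exp_half_sq (c i))
  rw [Real.cosh_eq]
  simp [boolSign]

lemma pow_six_div_le_cosh (x : ℝ) : x ^ 6 / 720 ≤ Real.cosh x := by
  have h := Real.hasSum_cosh x
  have := le_hasSum h 3 (fun n _ => by
    rw [pow_mul]; positivity)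
  refine le_trans (le_of_eq ?_) this
  norm_num [Nat.factorial]

/-- Khintchine's inequality for the sixth moment. -/
lemma integral_sum_boolSign_pow_six_le (c : ι → ℝ) {s : ℝ} (hs : 0 < s)
    (hc : ∑ i, c i ^ 2 = s) :
    ∫ ε, (∑ i, c i * boolSign (ε i)) ^ 6 ∂signMeasure ι ≤ 1440 * s ^ 3 := by
  have hr : 0 < √s := Real.sqrt_pos.2 hs
  have hr2 : √s ^ 2 = s := Real.sq_sqrt hs.le
  have hmgf : ∀ l : ℝ, l ^ 2 * s = 1 →
      ∫ ε, Real.exp (l * ∑ i, c i * boolSign (ε i)) ∂signMeasure ι ≤ Real.exp (1 / 2) := by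
    intro l hl
    have := integral_exp_sum_boolSign_le fun i => l * c i
    simp only [mul_pow, ← Finset.mul_sum, hc, hl, mul_assoc] at this
    exact this
  -- The sixth power is dominated by 720 cosh of the sum scaled by 1/√s, the scale at which both
  -- exponential moments are at most e^(1/2) ≤ 2. The half in cosh turns 720 into 360.
  have h1 : ∀ ε : ι → Bool, (∑ i, c i * boolSign (ε i)) ^ 6 ≤
      360 * s ^ 3 * (Real.exp ((√s)⁻¹ * ∑ i, c i * boolSign (ε i)) +
        Real.exp (-(√s)⁻¹ * ∑ i, c i * boolSign (ε i))) := by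
    intro ε
    have := pow_six_div_le_cosh ((√s)⁻¹ * ∑ i, c i * boolSign (ε i))
    rw [Real.cosh_eq, mul_pow, inv_pow, show √s ^ 6 = (√s ^ 2) ^ 3 by ring, hr2, ← neg_mul] at this
    have h3 : 0 < s ^ 3 := by positivity
    have h4 := mul_le_mul_of_nonneg_left this (by positivity : 0 ≤ 720 * s ^ 3)
    field_simp at h4
    field_simp
    linarith
  have h2 : Real.exp (1 / 2) ≤ 2 := by
    have : Real.exp (1 / 2) ^ 2 ≤ 2 ^ 2 := by
      rw [← Real.exp_nat_mul]
      norm_num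
      linarith [Real.exp_one_lt_d9]
    exact le_of_sq_le_sq this (by norm_num)
  calc _ ≤ ∫ ε, 360 * s ^ 3 * (Real.exp ((√s)⁻¹ * ∑ i, c i * boolSign (ε i)) +
        Real.exp (-(√s)⁻¹ * ∑ i, c i * boolSign (ε i))) ∂signMeasure ι :=
        integral_mono .of_finite .of_finite h1
    _ = 360 * s ^ 3 * (∫ ε, Real.exp ((√s)⁻¹ * ∑ i, c i * boolSign (ε i)) ∂signMeasure ι +
        ∫ ε, Real.exp (-(√s)⁻¹ * ∑ i, c i * boolSign (ε i)) ∂signMeasure ι) := by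
        rw [integral_const_mul, integral_add .of_finite .of_finite]
    _ ≤ 360 * s ^ 3 * (2 + 2) := by
        have ha := hmgf (√s)⁻¹ (by rw [inv_pow, hr2]; field_simp)
        have hb := hmgf (-(√s)⁻¹) (by rw [neg_sq, inv_pow, hr2]; field_simp)
        gcongr <;> linarith
    _ = 1440 * s ^ 3 := by ring

/-- A second moment bound for a Rademacher chaos with possibly repeated monomials. -/
lemma integral_chaos_sq_le [DecidableEq ι] {T : Type*} [Fintype T] (f : T → Finset ι)
    (c : T → ℝ) (C : ℝ)
    (hC : ∀ t, ((Finset.univ.filter fun t' => f t' = f t).card : ℝ) ≤ C) :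
    ∫ ε, (∑ t, c t * ∏ i ∈ f t, boolSign (ε i)) ^ 2 ∂signMeasure ι ≤ C * ∑ t, c t ^ 2 := by
  have h1 : ∫ ε, (∑ t, c t * ∏ i ∈ f t, boolSign (ε i)) ^ 2 ∂signMeasure ι =
      ∑ t, ∑ t', c t * c t' * (if f t = f t' then 1 else 0) := by
    simp_rw [sq, Finset.sum_mul_sum]
    rw [integral_finsetSum _ fun _ _ => .of_finite]
    refine Finset.sum_congr rfl fun t _ => ?_
    rw [integral_finsetSum _ fun _ _ => .of_finite]
    refine Finset.sum_congr rfl fun t' _ => ?_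
    rw [← integral_prod_boolSign_mul, ← integral_const_mul]
    exact integral_congr_ae (.of_forall fun ε => by ring)
  -- Only monomials with equal supports correlate; the arithmetic-geometric mean inequality on such
  -- pairs leaves a count of collisions, bounded by C.
  have h2 : ∀ t t', c t * c t' * (if f t = f t' then 1 else 0) ≤
      (c t ^ 2 * (if f t' = f t then 1 else 0) + c t' ^ 2 * (if f t = f t' then 1 else 0)) / 2 := by
    intro t t'
    by_cases h : f t = f t'
    · simp only [h, if_true]
      nlinarith [sq_nonneg (c t - c t')]
    · simp [h, Ne.symm h]
  have h3 : ∀ t, ∑ t', c t ^ 2 * (if f t' = f t then (1 : ℝ) else 0) ≤ C * c t ^ 2 := by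
    intro t
    rw [← Finset.mul_sum, Finset.sum_boole, mul_comm]
    exact mul_le_mul_of_nonneg_right (hC t) (sq_nonneg _)
  rw [h1]
  calc _ ≤ ∑ t, ∑ t', (c t ^ 2 * (if f t' = f t then 1 else 0) +
        c t' ^ 2 * (if f t = f t' then 1 else 0)) / 2 :=
        Finset.sum_le_sum fun t _ => Finset.sum_le_sum fun t' _ => h2 t t'
    _ = ∑ t, ∑ t', c t ^ 2 * (if f t' = f t then (1 : ℝ) else 0) := by
        simp_rw [← Finset.sum_div, Finset.sum_add_distrib]
        rw [Finset.sum_comm (f := fun t t' => c t' ^ 2 * (if f t = f t' then (1 : ℝ) else 0))]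
        ring
    _ ≤ ∑ t, C * c t ^ 2 := Finset.sum_le_sum fun t _ => h3 t
    _ = _ := by rw [Finset.mul_sum]

end Signs

/-! ### The conditional variance as a quartic form in the signs. -/

section RandomSigns

variable {ι : Type*} [Fintype ι]

/-- The coordinates of `H D a`, for the signs `D` encoded by `ε`. -/
def signedTransform (H : Matrix ι ι ℝ) (ε : ι → Bool) (a : ι → ℝ) (i : ι) : ℝ :=
  ∑ j, H i j * a j * boolSign (ε j)

/-- The rescaled sum of squares of the products of the coordinates of `H D a` and `H D a'`. -/
def conditionalVariance (H : Matrix ι ι ℝ) (a a' : ι → ℝ) (ε : ι → Bool) : ℝ :=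
  (Fintype.card ι : ℝ) * ∑ i, (signedTransform H ε a i) ^ 2 * (signedTransform H ε a' i) ^ 2

lemma conditionalVariance_nonneg (H : Matrix ι ι ℝ) (a a' : ι → ℝ) (ε : ι → Bool) :
    0 ≤ conditionalVariance H a a' ε := by
  unfold conditionalVariance; positivity

lemma conditionalVariance_comm (H : Matrix ι ι ℝ) (a a' : ι → ℝ) (ε : ι → Bool) :
    conditionalVariance H a a' ε = conditionalVariance H a' a ε := by
  unfold conditionalVariance; simp_rw [mul_comm]

lemma conditionalVariance_eq_sum (H : Matrix ι ι ℝ) (a a' : ι → ℝ) (ε : ι → Bool) :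
    conditionalVariance H a a' ε = ∑ j, ∑ k, ∑ p, ∑ q, a j * a k * a' p * a' q *
      (fourKernel H j k p q *
        (boolSign (ε j) * boolSign (ε k) * boolSign (ε p) * boolSign (ε q))) := by
  unfold conditionalVariance signedTransform fourKernel
  simp_rw [sq, Finset.sum_mul_sum]
  rw [Finset.mul_sum]
  simp_rw [Finset.mul_sum, Finset.sum_mul, Finset.mul_sum]
  rw [Finset.sum_comm]
  refine Finset.sum_congr rfl fun j _ => ?_
  rw [Finset.sum_comm]
  conv_rhs => rw [Finset.sum_comm]
  refine Finset.sum_congr rfl fun p _ => ?_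
  rw [Finset.sum_comm]
  refine Finset.sum_congr rfl fun k _ => ?_
  rw [Finset.sum_comm]
  refine Finset.sum_congr rfl fun q _ => ?_
  exact Finset.sum_congr rfl fun i _ => by ring

variable [DecidableEq ι] {H : Matrix ι ι ℝ}

/-- The coefficients H i j · a j have squares summing to 1/N, however localized a is. -/
lemma IsNormalizedHadamard.integral_signedTransform_pow_six_le (hH : IsNormalizedHadamard H)
    {a : ι → ℝ} (ha : ∑ j, a j ^ 2 = 1) (i : ι) :
    ∫ ε, signedTransform H ε a i ^ 6 ∂signMeasure ι ≤ 1440 * (1 / (Fintype.card ι : ℝ)) ^ 3 := by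
  have : Nonempty ι := ⟨i⟩
  refine integral_sum_boolSign_pow_six_le (fun j => H i j * a j) (by positivity) ?_
  simp_rw [mul_pow, hH.sq_apply, ← Finset.mul_sum, ha, mul_one]

/-- A coincidence between two indices reduces the kernel to the indicator that the other two agree,
and then all signs cancel. The three pairings account for these terms; the all-equal quadruple is
counted three times, hence the correction by 2. -/
lemma IsNormalizedHadamard.fourKernel_mul_signs (hH : IsNormalizedHadamard H) (ε : ι → Bool)
    (j k p q : ι) :
    fourKernel H j k p q *
        (boolSign (ε j) * boolSign (ε k) * boolSign (ε p) * boolSign (ε q)) =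
      (if j = k then if p = q then 1 else 0 else 0) +
      (if j = p then if k = q then 1 else 0 else 0) +
      (if j = q then if k = p then 1 else 0 else 0) -
      2 * (if j = k then if k = p then if p = q then 1 else 0 else 0 else 0) +
      (if [j, k, p, q].Nodup then fourKernel H j k p q else 0) *
        ∏ i ∈ {j, k, p, q}, boolSign (ε i) := by
  by_cases hnd : [j, k, p, q].Nodup
  · simp only [List.nodup_cons, List.mem_cons, List.not_mem_nil, or_false, not_or] at hnd
    obtain ⟨⟨h1, h2, h3⟩, ⟨h4, h5⟩, h6, -⟩ := hnd
    rw [Finset.prod_insert (by simp [h1, h2, h3]), Finset.prod_insert (by simp [h4, h5]),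
      Finset.prod_pair h6]
    simp [h1, h2, h3, h4, h5, h6, mul_assoc]
  · rw [if_neg hnd, zero_mul, add_zero]
    have hs := fun i => boolSign_mul_self (ε i)
    have hK := hH.fourKernel_self
    have hJP : ∀ j k q, fourKernel H j k j q = if k = q then 1 else 0 := fun j k q => by
      rw [fourKernel_swap_mid, hK]
    have hJQ : ∀ j k p, fourKernel H j k p j = if k = p then 1 else 0 := fun j k p => by
      rw [fourKernel_swap_right, hJP]
    have hKP : ∀ j k q, fourKernel H j k k q = if j = q then 1 else 0 := fun j k q => by
      rw [fourKernel_swap_left, hJP]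
    have hKQ : ∀ j k p, fourKernel H j k p k = if j = p then 1 else 0 := fun j k p => by
      rw [fourKernel_swap_left, hJQ]
    have hPQ : ∀ j k p, fourKernel H j k p p = if j = k then 1 else 0 := fun j k p => by
      rw [fourKernel_swap_mid, hKQ]
    have hs4 : ∀ x y : ι, boolSign (ε x) * boolSign (ε x) * boolSign (ε y) * boolSign (ε y) = 1 ∧
        boolSign (ε x) * boolSign (ε y) * boolSign (ε x) * boolSign (ε y) = 1 ∧
        boolSign (ε x) * boolSign (ε y) * boolSign (ε y) * boolSign (ε x) = 1 := by
      intro x y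
      refine ⟨?_, ?_, ?_⟩ <;>
    linear_combination (boolSign (ε y) * boolSign (ε y)) * hs x + hs y
    have hcases : j = k ∨ j = p ∨ j = q ∨ k = p ∨ k = q ∨ p = q := by
      by_contra hc
      simp only [not_or] at hc
      exact hnd (by simp [hc])
    rcases hcases with rfl | rfl | rfl | rfl | rfl | rfl
    · rw [hK]
      by_cases h : p = q
      · subst h
        rcases eq_or_ne j p with rfl | h'
        · simp [hs4]; norm_num
        · simp [h', hs4]
      · have : ¬ (j = p ∧ j = q) := fun hh => h (hh.1.symm.trans hh.2)
        by_cases h' : j = p <;> by_cases h'' : j = q <;> simp_all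
    · rw [hJP]
      by_cases h : k = q
      · subst h
        rcases eq_or_ne j k with rfl | h'
        · simp [hs4]; norm_num
        · simp [h', hs4]
      · by_cases h' : j = k <;> by_cases h'' : j = q <;> simp_all [eq_comm]
    · rw [hJQ]
      by_cases h : k = p
      · subst h
        rcases eq_or_ne j k with rfl | h'
        · simp [hs4]; norm_num
        · simp [h', hs4]
      · by_cases h' : j = k <;> by_cases h'' : j = p <;> simp_all [eq_comm]
    · rw [hKP]
      by_cases h : j = q
      · subst h
        rcases eq_or_ne j k with rfl | h'
        · simp [hs4]; norm_num
        · simp [h', hs4]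
      · by_cases h' : j = k <;> by_cases h'' : k = q <;> simp_all
    · rw [hKQ]
      by_cases h : j = p
      · subst h
        rcases eq_or_ne j k with rfl | h'
        · simp [hs4]; norm_num
        · simp [h', hs4]
      · by_cases h' : j = k <;> by_cases h'' : k = p <;> simp_all [eq_comm]
    · rw [hPQ]
      by_cases h : j = k
      · subst h
        rcases eq_or_ne j p with rfl | h'
        · simp [hs4]; norm_num
        · simp [h', hs4]
      · by_cases h' : j = p <;> by_cases h'' : k = p <;> simp_all [eq_comm]

/-- The off-diagonal chaos coefficients of the conditional variance. -/
def chaosCoeff (H : Matrix ι ι ℝ) (a a' : ι → ℝ) (t : ι × ι × ι × ι) : ℝ :=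
  a t.1 * a t.2.1 * a' t.2.2.1 * a' t.2.2.2 *
    if [t.1, t.2.1, t.2.2.1, t.2.2.2].Nodup then fourKernel H t.1 t.2.1 t.2.2.1 t.2.2.2 else 0

/-- The set of indices in a quadruple. -/
def quadSupport (t : ι × ι × ι × ι) : Finset ι := {t.1, t.2.1, t.2.2.1, t.2.2.2}

/-- The pairing within a and within a' sums to ‖a‖²‖a'‖² = 1, the two cross pairings to (aᵀa')²
each; distinct indices remain as a mean-zero chaos. -/
lemma IsNormalizedHadamard.conditionalVariance_decomposition (hH : IsNormalizedHadamard H)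
    {a a' : ι → ℝ} (ha : ∑ j, a j ^ 2 = 1) (ha' : ∑ j, a' j ^ 2 = 1) (ε : ι → Bool) :
    conditionalVariance H a a' ε = 1 + 2 * (∑ j, a j * a' j) ^ 2 - 2 * ∑ j, a j ^ 2 * a' j ^ 2 +
      ∑ t, chaosCoeff H a a' t * ∏ i ∈ quadSupport t, boolSign (ε i) := by
  have h1 : ∑ j, ∑ k, ∑ p, ∑ q, a j * a k * a' p * a' q *
      (if j = k then if p = q then (1 : ℝ) else 0 else 0) = 1 := by
    simp only [mul_ite, mul_one, mul_zero, Finset.sum_ite_irrel, Finset.sum_const_zero,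
      Finset.sum_ite_eq, Finset.mem_univ, if_true]
    calc _ = (∑ j, a j ^ 2) * ∑ p, a' p ^ 2 := by
          rw [Finset.sum_mul_sum]
          exact Finset.sum_congr rfl fun j _ => Finset.sum_congr rfl fun p _ => by ring
      _ = 1 := by rw [ha, ha', one_mul]
  have h2 : ∑ j, ∑ k, ∑ p, ∑ q, a j * a k * a' p * a' q *
      (if j = p then if k = q then (1 : ℝ) else 0 else 0) = (∑ j, a j * a' j) ^ 2 := by
    simp only [mul_ite, mul_one, mul_zero, Finset.sum_ite_irrel, Finset.sum_const_zero,
      Finset.sum_ite_eq, Finset.mem_univ, if_true]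
    rw [sq, Finset.sum_mul_sum]
    exact Finset.sum_congr rfl fun j _ => Finset.sum_congr rfl fun p _ => by ring
  have h3 : ∑ j, ∑ k, ∑ p, ∑ q, a j * a k * a' p * a' q *
      (if j = q then if k = p then (1 : ℝ) else 0 else 0) = (∑ j, a j * a' j) ^ 2 := by
    simp only [mul_ite, mul_one, mul_zero, Finset.sum_ite_eq, Finset.mem_univ, if_true]
    rw [sq, Finset.sum_mul_sum]
    exact Finset.sum_congr rfl fun j _ => Finset.sum_congr rfl fun p _ => by ring
  have h4 : ∑ j, ∑ k, ∑ p, ∑ q, a j * a k * a' p * a' q *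
      (2 * if j = k then if k = p then if p = q then (1 : ℝ) else 0 else 0 else 0) =
      2 * ∑ j, a j ^ 2 * a' j ^ 2 := by
    simp only [mul_ite, mul_one, mul_zero, Finset.sum_ite_irrel, Finset.sum_const_zero,
      Finset.sum_ite_eq, Finset.mem_univ, if_true]
    rw [Finset.mul_sum]
    exact Finset.sum_congr rfl fun j _ => by ring
  rw [conditionalVariance_eq_sum]
  simp_rw [hH.fourKernel_mul_signs]
  simp only [Fintype.sum_prod_type, chaosCoeff, quadSupport]
  simp only [mul_add, mul_sub, Finset.sum_add_distrib, Finset.sum_sub_distrib]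
  rw [h1, h2, h3, h4]
  simp only [mul_assoc]
  ring

/-- 256 = 4⁴: quadruples with the same support have all entries in one set of at most four elements.
-/
lemma card_quadSupport_fiber_le (t : ι × ι × ι × ι) :
    ((Finset.univ.filter fun t' => quadSupport t' = quadSupport t).card : ℝ) ≤ 256 := by
  have h1 : (quadSupport t).card ≤ 4 := Finset.card_le_four
  have h2 : (Finset.univ.filter fun t' => quadSupport t' = quadSupport t) ⊆
      quadSupport t ×ˢ quadSupport t ×ˢ quadSupport t ×ˢ quadSupport t := by
    intro t' ht'
    have ht' : quadSupport t' = quadSupport t := by simpa using ht'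
    rw [← ht']
    simp [quadSupport]
  have h3 := Finset.card_le_card h2
  simp only [Finset.card_product] at h3
  have h4 : (quadSupport t).card * ((quadSupport t).card *
      ((quadSupport t).card * (quadSupport t).card)) ≤ 4 * (4 * (4 * 4)) := by gcongr
  exact_mod_cast h3.trans (h4.trans (by norm_num))

/-- The sup bound is spent on the single factor a' q; the free sum over q is then 1 by Parseval, and
the other three sums are squared norms. This is why delocalization of one vector suffices. -/
lemma IsNormalizedHadamard.sum_chaosCoeff_sq_le (hH : IsNormalizedHadamard H)
    {a a' : ι → ℝ} (ha : ∑ j, a j ^ 2 = 1) (ha' : ∑ j, a' j ^ 2 = 1) {M : ℝ}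
    (hM : ∀ j, |a' j| ≤ M) :
    ∑ t, chaosCoeff H a a' t ^ 2 ≤ M ^ 2 := by
  have h1 : ∀ j k p q, chaosCoeff H a a' (j, k, p, q) ^ 2 ≤
      a j ^ 2 * (a k ^ 2 * (a' p ^ 2 * (M ^ 2 * fourKernel H j k p q ^ 2))) := by
    intro j k p q
    have hq : a' q ^ 2 ≤ M ^ 2 := sq_le_sq' (abs_le.1 (hM q)).1 (abs_le.1 (hM q)).2
    have h0 : chaosCoeff H a a' (j, k, p, q) ^ 2 ≤
        a j ^ 2 * (a k ^ 2 * (a' p ^ 2 * (a' q ^ 2 * fourKernel H j k p q ^ 2))) := by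
      unfold chaosCoeff
      dsimp only
      split_ifs
      · exact le_of_eq (by ring)
      · simp only [mul_zero, ne_eq, OfNat.ofNat_ne_zero, not_false_eq_true, zero_pow]
        positivity
    refine h0.trans ?_
    gcongr
  simp only [Fintype.sum_prod_type]
  calc _ ≤ ∑ j, ∑ k, ∑ p, ∑ q,
        a j ^ 2 * (a k ^ 2 * (a' p ^ 2 * (M ^ 2 * fourKernel H j k p q ^ 2))) := by
        gcongr
        exact h1 _ _ _ _
    _ = M ^ 2 := by
        simp_rw [← Finset.mul_sum, hH.sum_fourKernel_sq, mul_one]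
        simp only [← Finset.sum_mul, ha', ha, one_mul]

lemma IsNormalizedHadamard.integral_abs_conditionalVariance_sub_le_aux
    (hH : IsNormalizedHadamard H) {a a' : ι → ℝ} (ha : ∑ j, a j ^ 2 = 1)
    (ha' : ∑ j, a' j ^ 2 = 1) {M : ℝ} (hM : ∀ j, |a' j| ≤ M) :
    ∫ ε, |conditionalVariance H a a' ε - (1 + 2 * (∑ j, a j * a' j) ^ 2)| ∂signMeasure ι ≤
      16 * M + 2 * M ^ 2 := by
  have hM0 : 0 ≤ M := by
    obtain ⟨j⟩ : Nonempty ι := by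
      by_contra h
      rw [not_nonempty_iff] at h
      simp at ha
    exact (abs_nonneg _).trans (hM j)
  have hdiag : ∑ j, a j ^ 2 * a' j ^ 2 ≤ M ^ 2 := by
    calc _ ≤ ∑ j, a j ^ 2 * M ^ 2 := by
          refine Finset.sum_le_sum fun j _ => ?_
          have := sq_le_sq' (abs_le.1 (hM j)).1 (abs_le.1 (hM j)).2
          gcongr
      _ = M ^ 2 := by rw [← Finset.sum_mul, ha, one_mul]
  have hdiag0 : 0 ≤ ∑ j, a j ^ 2 * a' j ^ 2 := by positivity
  set Q : (ι → Bool) → ℝ := fun ε =>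
    ∑ t, chaosCoeff H a a' t * ∏ i ∈ quadSupport t, boolSign (ε i) with hQ
  have hQ2 : ∫ ε, Q ε ^ 2 ∂signMeasure ι ≤ 256 * M ^ 2 := by
    refine (integral_chaos_sq_le quadSupport _ 256 card_quadSupport_fiber_le).trans ?_
    gcongr
    exact hH.sum_chaosCoeff_sq_le ha ha' hM
  -- Nonnegativity of the variance of |Q| gives (E|Q|)² ≤ E Q², and 16 = √256.
  have hQ1 : ∫ ε, |Q ε| ∂signMeasure ι ≤ 16 * M := by
    have h := variance_nonneg (fun ε => |Q ε|) (signMeasure ι)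
    rw [variance_eq_sub .of_discrete] at h
    simp only [Pi.pow_apply, sq_abs] at h
    refine abs_le_of_sq_le_sq' ?_ (by positivity) |>.2
    linarith
  calc _ ≤ ∫ ε, (|Q ε| + 2 * M ^ 2) ∂signMeasure ι := by
        refine integral_mono .of_finite .of_finite fun ε => ?_
        rw [hH.conditionalVariance_decomposition ha ha']
        change |_ - _ + Q ε - _| ≤ _
        have : (1 + 2 * (∑ j, a j * a' j) ^ 2 - 2 * ∑ j, a j ^ 2 * a' j ^ 2 + Q ε -
          (1 + 2 * (∑ j, a j * a' j) ^ 2)) = Q ε - 2 * ∑ j, a j ^ 2 * a' j ^ 2 := by ring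
        rw [this]
        refine (abs_sub _ _).trans ?_
        rw [abs_of_nonneg (by positivity : 0 ≤ 2 * ∑ j, a j ^ 2 * a' j ^ 2)]
        linarith
    _ = ∫ ε, |Q ε| ∂signMeasure ι + 2 * M ^ 2 := by
        rw [integral_add .of_finite .of_finite]
        simp
    _ ≤ _ := by linarith

/-- The conditional variance concentrates when one of the vectors is delocalized. -/
lemma IsNormalizedHadamard.integral_abs_conditionalVariance_sub_le
    (hH : IsNormalizedHadamard H) {a a' : ι → ℝ} (ha : ∑ j, a j ^ 2 = 1)
    (ha' : ∑ j, a' j ^ 2 = 1) {M : ℝ} (hM : (∀ j, |a j| ≤ M) ∨ ∀ j, |a' j| ≤ M) :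
    ∫ ε, |conditionalVariance H a a' ε - (1 + 2 * (∑ j, a j * a' j) ^ 2)| ∂signMeasure ι ≤
      16 * M + 2 * M ^ 2 := by
  rcases hM with hM | hM
  · have := hH.integral_abs_conditionalVariance_sub_le_aux ha' ha hM
    simp_rw [conditionalVariance_comm H a' a, mul_comm (a' _)] at this
    exact this
  · exact hH.integral_abs_conditionalVariance_sub_le_aux ha ha' hM

end RandomSigns

/-! ### Characteristic functions of centred Bernoulli sums -/

/-- Taylor's remainder for |x| ≤ 1; for |x| > 1 every term is already dominated by |x|³. -/
lemma norm_cexp_mul_I_sub_taylor_le (x : ℝ) :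
    ‖Complex.exp (x * Complex.I) - (1 + x * Complex.I - x ^ 2 / 2)‖ ≤ 4 * |x| ^ 3 := by
  rcases le_or_gt |x| 1 with hx | hx
  · have h := Complex.exp_bound (x := x * Complex.I) (by simpa using hx) (n := 3) (by norm_num)
    have h2 : ∑ m ∈ Finset.range 3, (x * Complex.I : ℂ) ^ m / m.factorial =
        1 + x * Complex.I - x ^ 2 / 2 := by
      simp [Finset.sum_range_succ, mul_pow]
      ring
    rw [h2] at h
    refine h.trans ?_
    have h3 : 0 ≤ |x| ^ 3 := by positivity
    norm_num [Nat.factorial]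
    linarith
  · have h1 : ‖Complex.exp (x * Complex.I)‖ = 1 := Complex.norm_exp_ofReal_mul_I x
    have h2 : ‖(1 + x * Complex.I - x ^ 2 / 2 : ℂ)‖ ≤ 1 + |x| + |x| ^ 2 / 2 := by
      refine (norm_sub_le _ _).trans (add_le_add ((norm_add_le _ _).trans (by simp)) (by simp))
    refine (norm_sub_le _ _).trans ?_
    rw [h1]
    have h3 : |x| ≤ |x| ^ 3 := by
      calc |x| = |x| ^ 1 := (pow_one _).symm
        _ ≤ _ := pow_le_pow_right₀ hx.le (by norm_num)
    have h4 : |x| ^ 2 ≤ |x| ^ 3 := pow_le_pow_right₀ hx.le (by norm_num)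
    have h5 : (1 : ℝ) ≤ |x| ^ 3 := one_le_pow₀ hx.le
    linarith

/-- Both bounds are needed: for y of order s², a cubic error in s follows from y² when |s| ≤ 1 and
from y when |s| > 1. -/
lemma abs_exp_neg_sub_le {y : ℝ} (hy : 0 ≤ y) :
    |Real.exp (-y) - (1 - y)| ≤ y ∧ |Real.exp (-y) - (1 - y)| ≤ y ^ 2 := by
  have h1 := Real.add_one_le_exp (-y)
  have h2 : Real.exp (-y) ≤ 1 := by simpa using hy
  rw [abs_of_nonneg (by linarith)]
  refine ⟨by linarith, ?_⟩
  rcases le_or_gt y 1 with h | h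
  · have := Real.abs_exp_sub_one_sub_id_le (x := -y) (by rwa [abs_neg, abs_of_nonneg hy])
    have := (abs_le.1 this).2
    linarith [neg_sq y]
  · nlinarith

/-- Lindeberg replacement: factors are exchanged one at a time while the others stay in the unit
disc. -/
lemma norm_prod_sub_prod_le_sum {ι : Type*} (s : Finset ι) (a b : ι → ℂ)
    (ha : ∀ i, ‖a i‖ ≤ 1) (hb : ∀ i, ‖b i‖ ≤ 1) :
    ‖∏ i ∈ s, a i - ∏ i ∈ s, b i‖ ≤ ∑ i ∈ s, ‖a i - b i‖ := by
  classical
  induction s using Finset.induction_on with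
  | empty => simp
  | insert i s hi ih =>
    rw [Finset.prod_insert hi, Finset.prod_insert hi, Finset.sum_insert hi]
    have h1 : ‖∏ i ∈ s, a i‖ ≤ 1 := by
      rw [norm_prod]
      exact Finset.prod_le_one (fun _ _ => norm_nonneg _) fun i _ => ha i
    calc ‖a i * ∏ i ∈ s, a i - b i * ∏ i ∈ s, b i‖
        = ‖(a i - b i) * ∏ i ∈ s, a i + b i * (∏ i ∈ s, a i - ∏ i ∈ s, b i)‖ := by
          congr 1; ring
      _ ≤ ‖a i - b i‖ * 1 + 1 * ‖∏ i ∈ s, a i - ∏ i ∈ s, b i‖ := by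
          refine (norm_add_le _ _).trans ?_
          rw [norm_mul, norm_mul]
          gcongr
          exact hb i
      _ ≤ _ := by linarith

/-- The characteristic function of a centred Bernoulli variable of parameter `γ`. -/
noncomputable def centredBernoulliCharFun (γ s : ℝ) : ℂ :=
  γ * Complex.exp ((s * (1 - γ) : ℝ) * Complex.I) +
    (1 - γ) * Complex.exp ((s * -γ : ℝ) * Complex.I)

lemma norm_centredBernoulliCharFun_le {γ : ℝ} (h0 : 0 ≤ γ) (h1 : γ ≤ 1) (s : ℝ) :
    ‖centredBernoulliCharFun γ s‖ ≤ 1 := by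
  refine (norm_add_le _ _).trans ?_
  rw [norm_mul, norm_mul, Complex.norm_exp_ofReal_mul_I, Complex.norm_exp_ofReal_mul_I,
    ← Complex.ofReal_one, ← Complex.ofReal_sub, Complex.norm_real, Complex.norm_real,
    Real.norm_of_nonneg h0, Real.norm_of_nonneg (by linarith)]
  linarith

/-- The mean vanishes and the variance γ(1-γ) matches, so only cubic terms remain. The factor γ in
the error is what makes the bound effective for sparse sampling. -/
lemma norm_centredBernoulliCharFun_sub_exp_le {γ : ℝ} (h0 : 0 ≤ γ) (h1 : γ ≤ 1) (s : ℝ) :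
    ‖centredBernoulliCharFun γ s - (Real.exp (-(γ * (1 - γ) * s ^ 2 / 2)) : ℝ)‖ ≤
      5 * γ * |s| ^ 3 := by
  have hT1 := norm_cexp_mul_I_sub_taylor_le (s * (1 - γ))
  have hT2 := norm_cexp_mul_I_sub_taylor_le (s * -γ)
  set R1 := Complex.exp ((s * (1 - γ) : ℝ) * Complex.I) -
    (1 + (s * (1 - γ) : ℝ) * Complex.I - (s * (1 - γ) : ℝ) ^ 2 / 2) with hR1
  set R2 := Complex.exp ((s * -γ : ℝ) * Complex.I) -
    (1 + (s * -γ : ℝ) * Complex.I - (s * -γ : ℝ) ^ 2 / 2) with hR2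
  set y := γ * (1 - γ) * s ^ 2 / 2 with hy
  have h1' : 0 ≤ 1 - γ := by linarith
  have hy0 : 0 ≤ y := by positivity
  have hdec : centredBernoulliCharFun γ s - (Real.exp (-y) : ℝ) =
      γ * R1 + (1 - γ : ℝ) * R2 - ((Real.exp (-y) - (1 - y) : ℝ) : ℂ) := by
    rw [centredBernoulliCharFun, hR1, hR2, hy]
    push_cast
    ring
  have hs3 : 0 ≤ |s| ^ 3 := by positivity
  have hE : |Real.exp (-y) - (1 - y)| ≤ γ * |s| ^ 3 := by
    obtain ⟨ha, hb⟩ := abs_exp_neg_sub_le hy0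
    have hyle : y ≤ γ * |s| ^ 2 / 2 := by
      rw [hy, sq_abs]
      have : γ * (1 - γ) ≤ γ := by nlinarith
      gcongr
    rcases le_or_gt |s| 1 with hs | hs
    · refine hb.trans ?_
      have h4 : |s| ^ 4 ≤ |s| ^ 3 := pow_le_pow_of_le_one (abs_nonneg _) hs (by norm_num)
      calc y ^ 2 ≤ (γ * |s| ^ 2 / 2) ^ 2 := by gcongr
        _ = γ * γ * |s| ^ 4 / 4 := by ring
        _ ≤ γ * 1 * |s| ^ 3 / 1 := by gcongr; norm_num
        _ = _ := by ring
    · refine ha.trans (hyle.trans ?_)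
      have h4 : |s| ^ 2 ≤ |s| ^ 3 := pow_le_pow_right₀ hs.le (by norm_num)
      calc γ * |s| ^ 2 / 2 ≤ γ * |s| ^ 3 / 1 := by gcongr; norm_num
        _ = _ := by ring
  -- The third absolute moment of a centred Bernoulli variable is at most γ.
  have hpoly : γ * (1 - γ) ^ 3 + (1 - γ) * γ ^ 3 ≤ γ := by
    have : (1 - γ) * ((1 - γ) ^ 2 + γ ^ 2) ≤ 1 := by nlinarith [mul_nonneg h0 h1']
    nlinarith
  rw [hdec]
  calc _ ≤ ‖(γ : ℂ) * R1‖ + ‖((1 - γ : ℝ) : ℂ) * R2‖ +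
        ‖((Real.exp (-y) - (1 - y) : ℝ) : ℂ)‖ :=
        (norm_sub_le _ _).trans (add_le_add_left (norm_add_le _ _) _)
    _ ≤ γ * (4 * |s * (1 - γ)| ^ 3) + (1 - γ) * (4 * |s * -γ| ^ 3) + γ * |s| ^ 3 := by
        rw [norm_mul, norm_mul, Complex.norm_real, Complex.norm_real, Complex.norm_real,
          Real.norm_of_nonneg h0, Real.norm_of_nonneg h1', Real.norm_eq_abs]
        gcongr
    _ = 4 * (γ * (1 - γ) ^ 3 + (1 - γ) * γ ^ 3) * |s| ^ 3 + γ * |s| ^ 3 := by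
        rw [abs_mul, abs_mul, abs_neg, abs_of_nonneg h0, abs_of_nonneg h1']
        ring
    _ ≤ 4 * γ * |s| ^ 3 + γ * |s| ^ 3 := by gcongr
    _ = _ := by ring

lemma norm_prod_centredBernoulliCharFun_sub_exp_le {ι : Type*} [Fintype ι] {γ : ℝ} (h0 : 0 ≤ γ)
    (h1 : γ ≤ 1) (x : ι → ℝ) :
    ‖∏ i, centredBernoulliCharFun γ (x i) -
      (Real.exp (-(γ * (1 - γ) * (∑ i, x i ^ 2) / 2)) : ℝ)‖ ≤ 5 * γ * ∑ i, |x i| ^ 3 := by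
  have h2 : ((Real.exp (-(γ * (1 - γ) * (∑ i, x i ^ 2) / 2)) : ℝ) : ℂ) =
      ∏ i, ((Real.exp (-(γ * (1 - γ) * x i ^ 2 / 2)) : ℝ) : ℂ) := by
    rw [← Complex.ofReal_prod, ← Real.exp_sum, Finset.mul_sum, Finset.sum_div,
      Finset.sum_neg_distrib]
  rw [h2, Finset.mul_sum]
  refine (norm_prod_sub_prod_le_sum _ _ _ (fun i => norm_centredBernoulliCharFun_le h0 h1 _)
    fun i => ?_).trans (Finset.sum_le_sum fun i _ => norm_centredBernoulliCharFun_sub_exp_le h0 h1 _)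
  rw [Complex.norm_real, Real.norm_of_nonneg (Real.exp_pos _).le, Real.exp_le_one_iff]
  have : 0 ≤ γ * (1 - γ) := mul_nonneg h0 (by linarith)
  have := mul_nonneg this (sq_nonneg (x i))
  linarith

/-- The indicator attached to a Boolean. -/
def boolInd (b : Bool) : ℝ := cond b 1 0

/-- The law of a vector of independent Bernoulli selectors. -/
noncomputable def selectorMeasure (ι : Type*) [Fintype ι] (p : unitInterval) :
    Measure (ι → Bool) :=
  Measure.pi fun _ => bernoulliMeasure true false p

instance (ι : Type*) [Fintype ι] (p : unitInterval) :
    IsProbabilityMeasure (selectorMeasure ι p) := by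
  unfold selectorMeasure; infer_instance

lemma integral_cexp_selectorMeasure {ι : Type*} [Fintype ι] (p : unitInterval) (x : ι → ℝ) :
    ∫ s, Complex.exp ((∑ i, x i * (boolInd (s i) - p) : ℝ) * Complex.I) ∂selectorMeasure ι p =
      ∏ i, centredBernoulliCharFun p (x i) := by
  have h : ∀ s : ι → Bool, Complex.exp ((∑ i, x i * (boolInd (s i) - p) : ℝ) * Complex.I) =
      ∏ i, Complex.exp ((x i * (boolInd (s i) - p) : ℝ) * Complex.I) := by
    intro s
    rw [← Complex.exp_sum, ← Finset.sum_mul, Complex.ofReal_sum]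
  simp_rw [h]
  rw [selectorMeasure, integral_fintype_prod_eq_prod
    (fun i b => Complex.exp ((x i * (boolInd b - p) : ℝ) * Complex.I))]
  refine Finset.prod_congr rfl fun i _ => ?_
  rw [integral_bernoulliMeasure, centredBernoulliCharFun]
  simp [boolInd]

/-! ### Averaging the Gaussian approximation over the signs. -/

section Average

variable {ι : Type*} [Fintype ι] [DecidableEq ι] {H : Matrix ι ι ℝ}

/-- The condition on κ makes the variance of the weighted selector sum equal to
`conditionalVariance`. The cubic error is split by |uv|³ ≤ (u⁶ + v⁶)/2; N sixth moments of order N⁻³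
give N⁻², and 7200 = 5 · 1440. -/
lemma IsNormalizedHadamard.norm_integral_prod_sub_le (hH : IsNormalizedHadamard H)
    {a a' : ι → ℝ} (ha : ∑ j, a j ^ 2 = 1) (ha' : ∑ j, a' j ^ 2 = 1) {γ κ : ℝ} (h0 : 0 ≤ γ)
    (h1 : γ ≤ 1) (hκ0 : 0 ≤ κ) (hκ : γ * (1 - γ) * κ ^ 2 = Fintype.card ι) (t : ℝ) :
    ‖∫ ε, ∏ i, centredBernoulliCharFun γ
        (t * (κ * (signedTransform H ε a i * signedTransform H ε a' i))) ∂signMeasure ι -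
      ∫ ε, ((Real.exp (-(t ^ 2 * conditionalVariance H a a' ε / 2)) : ℝ) : ℂ) ∂signMeasure ι‖ ≤
      7200 * |t| ^ 3 * (γ * κ ^ 3 / (Fintype.card ι : ℝ) ^ 2) := by
  have : Nonempty ι := by
    by_contra h
    rw [not_nonempty_iff] at h
    simp at ha
  have hN : (Fintype.card ι : ℝ) ≠ 0 := by simp
  rw [← integral_sub .of_finite .of_finite]
  refine (norm_integral_le_integral_norm _).trans ?_
  set u := fun ε => signedTransform H ε a
  set v := fun ε => signedTransform H ε a'
  have hpt : ∀ ε, ‖∏ i, centredBernoulliCharFun γ (t * (κ * (u ε i * v ε i))) -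
      ((Real.exp (-(t ^ 2 * conditionalVariance H a a' ε / 2)) : ℝ) : ℂ)‖ ≤
      5 * γ * ∑ i, (|t| ^ 3 * κ ^ 3) * ((u ε i ^ 6 + v ε i ^ 6) / 2) := by
    intro ε
    have hV : t ^ 2 * conditionalVariance H a a' ε =
        γ * (1 - γ) * ∑ i, (t * (κ * (u ε i * v ε i))) ^ 2 := by
      have : ∀ i, (t * (κ * (u ε i * v ε i))) ^ 2 = (t ^ 2 * κ ^ 2) * (u ε i ^ 2 * v ε i ^ 2) :=
        fun i => by ring
      simp_rw [this, ← Finset.mul_sum]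
      rw [conditionalVariance, ← hκ]
      ring
    rw [hV]
    refine (norm_prod_centredBernoulliCharFun_sub_exp_le h0 h1 _).trans ?_
    gcongr with i _
    rw [abs_mul, abs_mul, abs_of_nonneg hκ0, mul_pow, mul_pow, abs_mul, mul_pow, ← mul_assoc]
    gcongr
    have h6 : ∀ x : ℝ, x ^ 6 = (|x| ^ 3) ^ 2 := fun x => by
      rw [← pow_mul, Even.pow_abs (by decide)]
    rw [h6, h6]
    nlinarith [sq_nonneg (|u ε i| ^ 3 - |v ε i| ^ 3)]
  calc _ ≤ ∫ ε, 5 * γ * ∑ i, (|t| ^ 3 * κ ^ 3) * ((u ε i ^ 6 + v ε i ^ 6) / 2) ∂signMeasure ι :=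
        integral_mono .of_finite .of_finite hpt
    _ = 5 * γ * ∑ i, (|t| ^ 3 * κ ^ 3) *
        ((∫ ε, u ε i ^ 6 ∂signMeasure ι + ∫ ε, v ε i ^ 6 ∂signMeasure ι) / 2) := by
        rw [integral_const_mul, integral_finsetSum _ fun _ _ => .of_finite]
        congr 1
        refine Finset.sum_congr rfl fun i _ => ?_
        rw [integral_const_mul, integral_div, integral_add .of_finite .of_finite]
    _ ≤ 5 * γ * ∑ i : ι, (|t| ^ 3 * κ ^ 3) *
        ((1440 * (1 / (Fintype.card ι : ℝ)) ^ 3 + 1440 * (1 / (Fintype.card ι : ℝ)) ^ 3) / 2) := by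
        gcongr with i _
        · exact hH.integral_signedTransform_pow_six_le ha i
        · exact hH.integral_signedTransform_pow_six_le ha' i
    _ = _ := by
        rw [Finset.sum_const, Finset.card_univ, nsmul_eq_mul]
        field_simp
        ring

end Average

/-! ### The law of the sketched bilinear form -/

section Law

variable {Ω : Type*} [MeasurableSpace Ω] {P : Measure Ω}

/-- Transfers the problem from an arbitrary probability space to finite Boolean cubes, where
measurability and integrability are automatic. -/
lemma map_prodMk_eq_of_iIndepFun {ι : Type*} [Fintype ι] {b d : ι → Ω → ℝ} {p : unitInterval}
    (hb : ∀ i, HasLaw (b i) (bernoulliMeasure 1 0 p) P) (hd : ∀ i, HasLaw (d i) rademacherLaw P)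
    (hind : iIndepFun (Sum.elim b d) P) :
    P.map (fun ω => ((fun i => b i ω, fun i => d i ω) : (ι → ℝ) × (ι → ℝ))) =
      ((selectorMeasure ι p).prod (signMeasure ι)).map
        (fun z => ((fun i => boolInd (z.1 i), fun i => boolSign (z.2 i)) :
          (ι → ℝ) × (ι → ℝ))) := by
  have hm : ∀ i, AEMeasurable (Sum.elim b d i) P := by
    rintro (i | i)
    · exact (hb i).aemeasurable
    · exact (hd i).aemeasurable
  have hP : IsProbabilityMeasure P := hind.isProbabilityMeasure
  have hprob : ∀ i, IsProbabilityMeasure (P.map (Sum.elim b d i)) := fun i =>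
    Measure.isProbabilityMeasure_map (hm i)
  have h1 := hind.map_fun_eq_pi_map hm
  have h2 := (measurePreserving_sumPiEquivProdPi fun i => P.map (Sum.elim b d i)).map_eq
  rw [← h1, AEMeasurable.map_map_of_aemeasurable
    (MeasurableEquiv.measurable _).aemeasurable (aemeasurable_pi_lambda _ hm)] at h2
  have h3 : (Measure.pi fun i => P.map (Sum.elim b d (Sum.inl i))) =
      (selectorMeasure ι p).map fun s i => boolInd (s i) := by
    have : ∀ _ : ι, IsProbabilityMeasure ((bernoulliMeasure true false p).map boolInd) :=
      fun _ => Measure.isProbabilityMeasure_map (by fun_prop)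
    rw [selectorMeasure, Measure.pi_map_pi fun _ => (by fun_prop)]
    congr 1
    funext i
    rw [map_bernoulliMeasure]
    exact (hb i).map_eq
  have h4 : (Measure.pi fun i => P.map (Sum.elim b d (Sum.inr i))) =
      (signMeasure ι).map fun s i => boolSign (s i) := by
    have : ∀ _ : ι, IsProbabilityMeasure ((bernoulliMeasure true false halfProb).map boolSign) :=
      fun _ => Measure.isProbabilityMeasure_map (by fun_prop)
    rw [signMeasure, Measure.pi_map_pi fun _ => (by fun_prop)]
    congr 1
    funext i
    rw [map_bernoulliMeasure]
    exact (hd i).map_eq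
  rw [h3, h4, Measure.map_prod_map _ _ (by fun_prop) (by fun_prop)] at h2
  exact h2

lemma sketchedForm_diagonal {n : ℕ} (r : ℝ) (hr : 0 ≤ r) (b d : Fin n → ℝ)
    (H : Matrix (Fin n) (Fin n) ℝ) (a a' : EuclideanSpace ℝ (Fin n)) :
    sketchedForm (√r • (diagonal b * H * diagonal d)) a a' =
      r * ∑ i, b i ^ 2 * ((∑ j, H i j * a j * d j) * ∑ j, H i j * a' j * d j) := by
  have hv : ∀ x : Fin n → ℝ, (√r • (diagonal b * H * diagonal d)) *ᵥ x =
      fun i => √r * (b i * ∑ j, H i j * x j * d j) := by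
    intro x
    funext i
    rw [Matrix.smul_mulVec, Pi.smul_apply, smul_eq_mul]
    congr 1
    rw [Finset.mul_sum]
    simp only [mulVec, dotProduct, mul_diagonal, diagonal_mul]
    exact Finset.sum_congr rfl fun j _ => by ring
  rw [sketchedForm, ← mulVec_mulVec, dotProduct_mulVec, vecMul_transpose, hv, hv, dotProduct,
    Finset.mul_sum]
  refine Finset.sum_congr rfl fun i _ => ?_
  calc _ = √r * √r * (b i ^ 2 * ((∑ j, H i j * a j * d j) * ∑ j, H i j * a' j * d j)) := by ring
    _ = _ := by rw [Real.mul_self_sqrt hr]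

/-- The sketched form as a function of Boolean selectors and signs. -/
noncomputable def booleanForm {n : ℕ} (H : Matrix (Fin n) (Fin n) ℝ) (r : ℝ) (a a' : Fin n → ℝ)
    (z : (Fin n → Bool) × (Fin n → Bool)) : ℝ :=
  r * ∑ i, boolInd (z.1 i) * (signedTransform H z.2 a i * signedTransform H z.2 a' i)

variable {l m : ℕ} {hm : m ≤ 2 ^ l} {S : Ω → Matrix (Fin (2 ^ l)) (Fin (2 ^ l)) ℝ}

lemma IsSRHT.aemeasurable_sketchedForm (hS : IsSRHT P l m hm S)
    (a a' : EuclideanSpace ℝ (Fin (2 ^ l))) :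
    AEMeasurable (fun ω => sketchedForm (S ω) a a') P := by
  obtain ⟨b, d, hb, hd, -, hS⟩ := hS
  have hb' := fun i => (hb i).aemeasurable
  have hd' := fun i => (hd i).aemeasurable
  simp_rw [hS, sketchedForm_diagonal _ (by positivity : (0 : ℝ) ≤ (2 ^ l : ℕ) / (m : ℝ))]
  fun_prop

lemma IsSRHT.map_sketchedForm (hS : IsSRHT P l m hm S)
    (a a' : EuclideanSpace ℝ (Fin (2 ^ l))) :
    P.map (fun ω => sketchedForm (S ω) a a') =
      ((selectorMeasure (Fin (2 ^ l)) (samplingProb m (2 ^ l) hm)).prod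
        (signMeasure (Fin (2 ^ l)))).map
        (booleanForm (hadamardMatrix l) ((2 ^ l : ℕ) / (m : ℝ)) a a') := by
  obtain ⟨b, d, hb, hd, hind, hS⟩ := hS
  have hb' := fun i => (hb i).aemeasurable
  have hd' := fun i => (hd i).aemeasurable
  have hmap := map_prodMk_eq_of_iIndepFun hb hd hind
  simp_rw [hS, sketchedForm_diagonal _ (by positivity : (0 : ℝ) ≤ (2 ^ l : ℕ) / (m : ℝ))]
  set F : (Fin (2 ^ l) → ℝ) × (Fin (2 ^ l) → ℝ) → ℝ := fun y =>
    (2 ^ l : ℕ) / (m : ℝ) * ∑ i, y.1 i ^ 2 * ((∑ j, hadamardMatrix l i j * a j * y.2 j) *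
      ∑ j, hadamardMatrix l i j * a' j * y.2 j) with hF
  have hFm : Measurable F := by fun_prop
  have h1 := congrArg (Measure.map F) hmap
  rw [AEMeasurable.map_map_of_aemeasurable hFm.aemeasurable
    ((aemeasurable_pi_lambda _ hb').prodMk (aemeasurable_pi_lambda _ hd')),
    Measure.map_map hFm (by fun_prop)] at h1
  refine h1.trans ?_
  congr 1
  funext z
  simp only [hF, Function.comp_apply, booleanForm, signedTransform]
  congr 1
  refine Finset.sum_congr rfl fun i _ => ?_
  cases z.1 i <;> simp [boolInd]

/-- H D is orthogonal for every sign pattern, so the conditional mean of the form does not depend on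
the signs. -/
lemma sum_signedTransform_mul {ι : Type*} [Fintype ι] [DecidableEq ι] {H : Matrix ι ι ℝ}
    (hH : IsNormalizedHadamard H) (a a' : ι → ℝ) (ε : ι → Bool) :
    ∑ i, signedTransform H ε a i * signedTransform H ε a' i = ∑ j, a j * a' j := by
  simp_rw [signedTransform, Finset.sum_mul_sum]
  rw [Finset.sum_comm]
  refine Finset.sum_congr rfl fun j _ => ?_
  rw [Finset.sum_comm]
  have h : ∀ k, ∑ i, H i j * a j * boolSign (ε j) * (H i k * a' k * boolSign (ε k)) =
      if j = k then a j * boolSign (ε j) * (a' k * boolSign (ε k)) else 0 := by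
    intro k
    have hk := hH.sum_col_mul_col j k
    calc _ = (∑ i, H i j * H i k) * (a j * boolSign (ε j) * (a' k * boolSign (ε k))) := by
          rw [Finset.sum_mul]
          exact Finset.sum_congr rfl fun i _ => by ring
      _ = _ := by rw [hk, ite_mul, one_mul, zero_mul]
  simp_rw [h]
  simp only [Finset.sum_ite_eq, Finset.mem_univ, if_true]
  linear_combination a j * a' j * boolSign_mul_self (ε j)

/-- The rescaled centred form is a weighted sum of centred selectors. -/
lemma booleanForm_sub {l m : ℕ} (hm : m ≤ 2 ^ l) (hm0 : 0 < m) (c : ℝ)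
    (a a' : Fin (2 ^ l) → ℝ) (z : (Fin (2 ^ l) → Bool) × (Fin (2 ^ l) → Bool)) :
    c * (booleanForm (hadamardMatrix l) ((2 ^ l : ℕ) / (m : ℝ)) a a' z - ∑ j, a j * a' j) =
      ∑ i, (c * ((2 ^ l : ℕ) / (m : ℝ)) * (signedTransform (hadamardMatrix l) z.2 a i *
        signedTransform (hadamardMatrix l) z.2 a' i)) *
        (boolInd (z.1 i) - samplingProb m (2 ^ l) hm) := by
  rw [← sum_signedTransform_mul (isNormalizedHadamard_hadamardMatrix l) a a' z.2, booleanForm,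
    Finset.mul_sum, ← Finset.sum_sub_distrib, Finset.mul_sum]
  refine Finset.sum_congr rfl fun i _ => ?_
  have : (m : ℝ) ≠ 0 := by positivity
  simp only [samplingProb]
  field_simp

/-- Fubini with the selectors integrated first: given the signs, the characteristic function
factorizes. -/
lemma IsSRHT.charFun_eq (hS : IsSRHT P l m hm S) (hm0 : 0 < m)
    (a a' : EuclideanSpace ℝ (Fin (2 ^ l))) (c t : ℝ) :
    charFun (P.map fun ω => c * (sketchedForm (S ω) a a' - a ⬝ᵥ a')) t =
      ∫ ε, ∏ i, centredBernoulliCharFun ((m : ℝ) / (2 ^ l : ℕ))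
        (t * (c * ((2 ^ l : ℕ) / (m : ℝ)) * (signedTransform (hadamardMatrix l) ε a i *
          signedTransform (hadamardMatrix l) ε a' i))) ∂signMeasure (Fin (2 ^ l)) := by
  have hmeas := hS.aemeasurable_sketchedForm a a'
  have h1 : P.map (fun ω => c * (sketchedForm (S ω) a a' - a ⬝ᵥ a')) =
      ((selectorMeasure (Fin (2 ^ l)) (samplingProb m (2 ^ l) hm)).prod
        (signMeasure (Fin (2 ^ l)))).map fun z => c *
        (booleanForm (hadamardMatrix l) ((2 ^ l : ℕ) / (m : ℝ)) a a' z - a ⬝ᵥ a') := by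
    have h := congrArg (Measure.map fun x => c * (x - a ⬝ᵥ a')) (hS.map_sketchedForm a a')
    rw [AEMeasurable.map_map_of_aemeasurable (by fun_prop) hmeas,
      AEMeasurable.map_map_of_aemeasurable (by fun_prop) (by fun_prop)] at h
    exact h
  rw [h1, charFun_apply_real, integral_map (by fun_prop) (by fun_prop),
    integral_prod_symm _ .of_finite]
  refine integral_congr_ae (.of_forall fun ε => ?_)
  have h2 := integral_cexp_selectorMeasure (samplingProb m (2 ^ l) hm) (fun i =>
    t * (c * ((2 ^ l : ℕ) / (m : ℝ)) * (signedTransform (hadamardMatrix l) ε a i *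
      signedTransform (hadamardMatrix l) ε a' i)))
  refine Eq.trans ?_ h2
  refine integral_congr_ae (.of_forall fun s => ?_)
  have h3 := booleanForm_sub hm hm0 c a a' (s, ε)
  simp only [dotProduct, h3, mul_assoc t, ← Finset.mul_sum, Complex.ofReal_mul]

/-- The characteristic function of the normalized form is close to a mixture of Gaussian
characteristic functions. -/
lemma IsSRHT.norm_charFun_sub_le (hS : IsSRHT P l m hm S) (hm0 : 0 < m) (hml : m < 2 ^ l)
    {a a' : EuclideanSpace ℝ (Fin (2 ^ l))} (ha : ‖a‖ = 1) (ha' : ‖a'‖ = 1) (t : ℝ) :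
    ‖charFun (P.map fun ω => √((m : ℝ) / (1 - (m : ℝ) / ((2 ^ l : ℕ) : ℝ))) *
        (sketchedForm (S ω) a a' - a ⬝ᵥ a')) t -
      ∫ ε, ((Real.exp (-(t ^ 2 * conditionalVariance (hadamardMatrix l) a a' ε / 2)) : ℝ) : ℂ)
        ∂signMeasure (Fin (2 ^ l))‖ ≤
      7200 * |t| ^ 3 * ((√m)⁻¹ * (√(1 - (m : ℝ) / ((2 ^ l : ℕ) : ℝ)) ^ 3)⁻¹) := by
  have hn0 : (0 : ℝ) < (2 ^ l : ℕ) := by positivity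
  have hmr : (0 : ℝ) < m := by exact_mod_cast hm0
  have hlt : (m : ℝ) / ((2 ^ l : ℕ) : ℝ) < 1 := by
    rw [div_lt_one hn0]; exact_mod_cast hml
  set n : ℝ := ((2 ^ l : ℕ) : ℝ) with hn
  set γ : ℝ := (m : ℝ) / n with hγ
  have h1γ : 0 < 1 - γ := by linarith
  have hunit : ∀ {x : EuclideanSpace ℝ (Fin (2 ^ l))}, ‖x‖ = 1 → ∑ j, x j ^ 2 = 1 := by
    intro x hx
    have := EuclideanSpace.norm_sq_eq x
    rw [hx] at this
    simpa using this.symm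
  rw [hS.charFun_eq hm0 a a']
  have hcard : (Fintype.card (Fin (2 ^ l)) : ℝ) = n := by rw [Fintype.card_fin]
  have hc2 : √((m : ℝ) / (1 - γ)) ^ 2 = m / (1 - γ) := Real.sq_sqrt (by positivity)
  -- This κ satisfies γ(1-γ)κ² = n, and γκ³/n² = m^(-1/2) (1-γ)^(-3/2), with n cancelling.
  have key := (isNormalizedHadamard_hadamardMatrix l).norm_integral_prod_sub_le (hunit ha)
    (hunit ha') (γ := γ) (κ := √((m : ℝ) / (1 - γ)) * (n / m)) (by positivity) hlt.le
    (by positivity) (by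
      have hγn : γ * n = m := div_mul_cancel₀ _ hn0.ne'
      rw [hcard, mul_pow, hc2]
      calc _ = γ * n * n / m * ((1 - γ) / (1 - γ)) * (m / m) := by ring
        _ = n := by
          rw [hγn, div_self h1γ.ne', div_self hmr.ne']
          field_simp) t
  refine key.trans (le_of_eq ?_)
  rw [hcard]
  congr 1
  have hs : √(m : ℝ) ^ 2 = m := Real.sq_sqrt hmr.le
  have hs0 : 0 < √(m : ℝ) := Real.sqrt_pos.2 hmr
  have hd0 : 0 < √(1 - γ) := Real.sqrt_pos.2 h1γ
  rw [Real.sqrt_div hmr.le]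
  have hγ' : γ = √(m : ℝ) ^ 2 / n := by rw [hs]
  generalize √(1 - γ) = w at *
  rw [hγ']
  have hmx : (m : ℝ) = √(m : ℝ) ^ 2 := hs.symm
  generalize √(m : ℝ) = x at *
  rw [hmx]
  field_simp

end Law

/-! ### The central limit theorem -/

lemma abs_exp_neg_sub_exp_neg_le {x y : ℝ} (hx : 0 ≤ x) (hy : 0 ≤ y) :
    |Real.exp (-x) - Real.exp (-y)| ≤ |x - y| := by
  wlog h : x ≤ y generalizing x y
  · rw [abs_sub_comm, abs_sub_comm x y]
    exact this hy hx (le_of_not_ge h)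
  have h1 : Real.exp (-y) ≤ Real.exp (-x) := Real.exp_le_exp.2 (by linarith)
  rw [abs_of_nonneg (by linarith), abs_sub_comm, abs_of_nonneg (by linarith)]
  have h2 : Real.exp (-y) = Real.exp (-x) * Real.exp (-(y - x)) := by
    rw [← Real.exp_add]; ring_nf
  have h3 := Real.add_one_le_exp (-(y - x))
  have h4 : Real.exp (-x) ≤ 1 := by simpa using hx
  have h5 := Real.exp_pos (-x)
  rw [h2]
  nlinarith

lemma abs_apply_le_linftyNorm {n : ℕ} (a : EuclideanSpace ℝ (Fin n)) (i : Fin n) :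
    |a i| ≤ linftyNorm a :=
  le_ciSup (f := fun i => |a i|) (Set.finite_range _).bddAbove i

/-- Once n ≥ 2, log n is bounded below by log 2, so m dominates a constant times m / log² n. -/
lemma SketchRegime.tendsto_m {l m : ℕ → ℕ} (h : SketchRegime l m) :
    Tendsto (fun k => (m k : ℝ)) atTop atTop := by
  have hl2 : 0 < Real.log 2 ^ 2 := by positivity
  refine tendsto_atTop_mono' _ ?_ (h.tendsto_size.atTop_mul_const hl2)
  filter_upwards [h.tendsto_dim.eventually_ge_atTop 2] with k hk
  have h1 : Real.log 2 ≤ Real.log ((2 ^ l k : ℕ) : ℝ) :=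
    Real.log_le_log (by norm_num) (by exact_mod_cast hk)
  have h0 : 0 < Real.log 2 := Real.log_pos (by norm_num)
  have h2 : 0 < Real.log ((2 ^ l k : ℕ) : ℝ) := h0.trans_le h1
  calc _ ≤ (m k : ℝ) / Real.log ((2 ^ l k : ℕ) : ℝ) ^ 2 *
        Real.log ((2 ^ l k : ℕ) : ℝ) ^ 2 := by gcongr
    _ = m k := div_mul_cancel₀ _ (by positivity)

/-- A uniform gap below 1 keeps the factor (1-γ)^(-3/2) of the error bounded. -/
lemma SketchRegime.exists_delta {l m : ℕ → ℕ} (h : SketchRegime l m) :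
    ∃ δ : ℝ, 0 < δ ∧ ∀ᶠ k in atTop, δ ≤ 1 - (m k : ℝ) / ((2 ^ l k : ℕ) : ℝ) := by
  obtain ⟨c, hc1, hc2⟩ := exists_between h.limsup_lt
  refine ⟨1 - c, by linarith, ?_⟩
  have hb : IsBoundedUnder (· ≤ ·) atTop fun k => (m k : ℝ) / ((2 ^ l k : ℕ) : ℝ) := by
    refine isBoundedUnder_of ⟨1, fun k => ?_⟩
    exact div_le_one_of_le₀ (by exact_mod_cast h.le k) (by positivity)
  filter_upwards [eventually_lt_of_limsup_lt hc1 hb] with k hk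
  linarith

section Limit

variable {Ω : ℕ → Type*} [∀ k, MeasurableSpace (Ω k)] {P : ∀ k, Measure (Ω k)}
  {l m : ℕ → ℕ} {S : ∀ k, Ω k → Matrix (Fin (2 ^ l k)) (Fin (2 ^ l k)) ℝ}

/-- The argument may vary boundedly with k, which absorbs k-dependent scalings: √(1/(1 + 2(aᵀa')²))
in the limit theorem and √(1-γ) in the counterexample. -/
lemma SketchRegime.tendsto_norm_charFun_sub (hreg : SketchRegime l m)
    (hS : ∀ k, IsSRHT (P k) (l k) (m k) (hreg.le k) (S k))
    {a a' : ∀ k, EuclideanSpace ℝ (Fin (2 ^ l k))} (ha : ∀ k, ‖a k‖ = 1)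
    (ha' : ∀ k, ‖a' k‖ = 1) {T : ℕ → ℝ} {B : ℝ} (hT : ∀ k, |T k| ≤ B) :
    Tendsto (fun k => ‖charFun ((P k).map fun ω =>
        √((m k : ℝ) / (1 - (m k : ℝ) / ((2 ^ l k : ℕ) : ℝ))) *
          (sketchedForm (S k ω) (a k) (a' k) - a k ⬝ᵥ a' k)) (T k) -
      ∫ ε, ((Real.exp (-(T k ^ 2 *
        conditionalVariance (hadamardMatrix (l k)) (a k) (a' k) ε / 2)) : ℝ) : ℂ)
        ∂signMeasure (Fin (2 ^ l k))‖) atTop (𝓝 0) := by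
  obtain ⟨δ, hδ, hδe⟩ := hreg.exists_delta
  have hm := hreg.tendsto_m
  have hlim : Tendsto (fun k => 7200 * B ^ 3 * ((√(m k : ℝ))⁻¹ * (√δ ^ 3)⁻¹)) atTop (𝓝 0) := by
    have h1 : Tendsto (fun k => (√(m k : ℝ))⁻¹) atTop (𝓝 0) :=
      tendsto_inv_atTop_zero.comp (Real.tendsto_sqrt_atTop.comp hm)
    simpa using (h1.mul_const ((√δ ^ 3)⁻¹)).const_mul (7200 * B ^ 3)
  refine squeeze_zero' (.of_forall fun k => norm_nonneg _) ?_ hlim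
  filter_upwards [hδe, hm.eventually_gt_atTop 0] with k hk hmk
  have hn : (0 : ℝ) < ((2 ^ l k : ℕ) : ℝ) := by positivity
  have hlt : m k < 2 ^ l k := by
    have : (m k : ℝ) / ((2 ^ l k : ℕ) : ℝ) < 1 := by linarith
    rw [div_lt_one hn] at this
    exact_mod_cast this
  refine ((hS k).norm_charFun_sub_le (by exact_mod_cast hmk) hlt (ha k) (ha' k) (T k)).trans ?_
  have hδs : 0 < √δ := Real.sqrt_pos.2 hδ
  have hB : 0 ≤ B := (abs_nonneg _).trans (hT k)
  gcongr
  exact hT k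

theorem SketchRegime.tendstoInDistribution [∀ k, IsProbabilityMeasure (P k)]
    (hreg : SketchRegime l m)
    (hS : ∀ k, IsSRHT (P k) (l k) (m k) (hreg.le k) (S k))
    {a a' : ∀ k, EuclideanSpace ℝ (Fin (2 ^ l k))} (ha : ∀ k, ‖a k‖ = 1)
    (ha' : ∀ k, ‖a' k‖ = 1) (hdeloc : Delocalized a a') :
    TendstoInDistribution
      (fun k ω => √((m k : ℝ) / (1 - (m k : ℝ) / ((2 ^ l k : ℕ) : ℝ))) *
        √(1 / (1 + 2 * (a k ⬝ᵥ a' k) ^ 2)) *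
        (sketchedForm (S k ω) (a k) (a' k) - a k ⬝ᵥ a' k))
      atTop id P (gaussianReal 0 1) := by
  have hmeas : ∀ k, AEMeasurable (fun ω => sketchedForm (S k ω) (a k) (a' k)) (P k) :=
    fun k => (hS k).aemeasurable_sketchedForm _ _
  refine ⟨fun k => by have := hmeas k; fun_prop, aemeasurable_id, ?_⟩
  refine ProbabilityMeasure.tendsto_iff_tendsto_charFun.2 fun t => ?_
  rw [ProbabilityMeasure.coe_mk, Measure.map_id, charFun_gaussianReal]
  simp only [ProbabilityMeasure.coe_mk]
  obtain ⟨M, hM0, hM⟩ : ∃ M : ℕ → ℝ, Tendsto M atTop (𝓝 0) ∧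
      ∀ k, (∀ j, |a k j| ≤ M k) ∨ ∀ j, |a' k j| ≤ M k := by
    rcases hdeloc with h | h
    · exact ⟨_, h, fun k => .inl (abs_apply_le_linftyNorm _)⟩
    · exact ⟨_, h, fun k => .inr (abs_apply_le_linftyNorm _)⟩
  have hunit : ∀ {k} {x : EuclideanSpace ℝ (Fin (2 ^ l k))}, ‖x‖ = 1 → ∑ j, x j ^ 2 = 1 := by
    intro k x hx
    have := EuclideanSpace.norm_sq_eq x
    rw [hx] at this
    simpa using this.symm
  set v : ℕ → ℝ := fun k => 1 + 2 * (a k ⬝ᵥ a' k) ^ 2 with hv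
  have hv1 : ∀ k, 1 ≤ v k := fun k => by simp only [hv]; linarith [sq_nonneg (a k ⬝ᵥ a' k)]
  set T : ℕ → ℝ := fun k => √(1 / v k) * t with hTdef
  have hs1 : ∀ k, √(1 / v k) ≤ 1 := fun k => by
    rw [Real.sqrt_le_one]
    exact div_le_one_of_le₀ (hv1 k) (by linarith [hv1 k])
  have hT : ∀ k, |T k| ≤ |t| := fun k => by
    rw [hTdef, abs_mul, abs_of_nonneg (Real.sqrt_nonneg _)]
    exact mul_le_of_le_one_left (abs_nonneg _) (hs1 k)
  have hTv : ∀ k, T k ^ 2 * v k = t ^ 2 := fun k => by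
    have h1 := hv1 k
    rw [hTdef, mul_pow, Real.sq_sqrt (by positivity)]
    field_simp
  have h1 := hreg.tendsto_norm_charFun_sub hS ha ha' hT
  -- The mixture collapses: exp(-x) is 1-Lipschitz on x ≥ 0, so L¹ concentration of the conditional
  -- variance suffices.
  have h2 : Tendsto (fun k => ‖∫ ε, ((Real.exp (-(T k ^ 2 *
        conditionalVariance (hadamardMatrix (l k)) (a k) (a' k) ε / 2)) : ℝ) : ℂ)
        ∂signMeasure (Fin (2 ^ l k)) - (Real.exp (-(t ^ 2 / 2)) : ℝ)‖) atTop (𝓝 0) := by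
    have hlim : Tendsto (fun k => t ^ 2 / 2 * (16 * M k + 2 * M k ^ 2)) atTop (𝓝 0) := by
      have := ((hM0.const_mul 16).add ((hM0.pow 2).const_mul 2)).const_mul (t ^ 2 / 2)
      simpa using this
    refine squeeze_zero (fun k => norm_nonneg _) (fun k => ?_) hlim
    rw [integral_complex_ofReal, ← Complex.ofReal_sub, Complex.norm_real]
    have h3 : Real.exp (-(t ^ 2 / 2)) =
        ∫ _ε, Real.exp (-(t ^ 2 / 2)) ∂signMeasure (Fin (2 ^ l k)) := by simp
    rw [h3, ← integral_sub .of_finite .of_finite]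
    refine (norm_integral_le_integral_norm _).trans ?_
    have h4 := (isNormalizedHadamard_hadamardMatrix (l k)).integral_abs_conditionalVariance_sub_le
      (hunit (ha k)) (hunit (ha' k)) (hM k)
    calc _ ≤ ∫ ε, T k ^ 2 / 2 * |conditionalVariance (hadamardMatrix (l k)) (a k) (a' k) ε - v k|
          ∂signMeasure (Fin (2 ^ l k)) := by
          refine integral_mono .of_finite .of_finite fun ε => ?_
          have hV := conditionalVariance_nonneg (hadamardMatrix (l k)) (a k) (a' k) ε
          refine (abs_exp_neg_sub_exp_neg_le (by positivity) (by positivity)).trans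
            (le_of_eq ?_)
          rw [← hTv k, ← abs_of_nonneg (by positivity : 0 ≤ T k ^ 2 / 2), ← abs_mul]
          congr 1
          ring
      _ = T k ^ 2 / 2 * ∫ ε, |conditionalVariance (hadamardMatrix (l k)) (a k) (a' k) ε - v k|
          ∂signMeasure (Fin (2 ^ l k)) := integral_const_mul _ _
      _ ≤ t ^ 2 / 2 * (16 * M k + 2 * M k ^ 2) := by
          gcongr ?_ / 2 * ?_
          · exact sq_le_sq.2 (hT k)
          · exact h4
  rw [tendsto_iff_norm_sub_tendsto_zero]
  have h12 := h1.add h2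
  rw [add_zero] at h12
  refine squeeze_zero (fun k => norm_nonneg _) (fun k => ?_) h12
  have hfun : (fun ω => √((m k : ℝ) / (1 - (m k : ℝ) / ((2 ^ l k : ℕ) : ℝ))) *
        √(1 / (1 + 2 * (a k ⬝ᵥ a' k) ^ 2)) *
        (sketchedForm (S k ω) (a k) (a' k) - a k ⬝ᵥ a' k)) =
      fun ω => √(1 / v k) * (√((m k : ℝ) / (1 - (m k : ℝ) / ((2 ^ l k : ℕ) : ℝ))) *
        (sketchedForm (S k ω) (a k) (a' k) - a k ⬝ᵥ a' k)) := by
    funext ω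
    simp only [hv]
    ring
  have hgauss : Complex.exp ((t : ℂ) * ((0 : ℝ) : ℂ) * Complex.I -
      (((1 : NNReal) : ℝ) : ℂ) * (t : ℂ) ^ 2 / 2) = ((Real.exp (-(t ^ 2 / 2)) : ℝ) : ℂ) := by
    push_cast
    congr 1
    ring
  rw [hfun, charFun_map_mul_comp (by have := hmeas k; fun_prop), hgauss]
  refine (le_of_eq ?_).trans (norm_add_le _ _)
  rw [sub_add_sub_cancel]

end Limit

/-! ### Localized vectors for which normality fails -/

section Atoms

/-- There is no atom at 0, so outer regularity gives a small neighbourhood of small mass. -/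
lemma exists_gaussianReal_Icc_lt {v : NNReal} (hv : v ≠ 0) :
    ∃ e : ℝ, 0 < e ∧ gaussianReal 0 v (Set.Icc (-e) e) < 1 / 2 := by
  have := nullSingletonClass_gaussianReal (μ := 0) hv
  obtain ⟨U, h0U, hU, hlt⟩ := Set.exists_isOpen_lt_of_lt (μ := gaussianReal 0 v) {(0 : ℝ)} (1 / 2)
    (by simp)
  obtain ⟨e, he, heU⟩ := Metric.isOpen_iff.1 hU 0 (h0U rfl)
  refine ⟨e / 2, by positivity, (measure_mono ?_).trans_lt hlt⟩
  refine subset_trans (fun x hx => ?_) heU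
  rw [Metric.mem_ball, Real.dist_eq, sub_zero, abs_lt]
  constructor <;> linarith [hx.1, hx.2]

lemma gaussianReal_Iic_neg_eq_Ici {v : NNReal} (e : ℝ) :
    gaussianReal 0 v (Set.Iic (-e)) = gaussianReal 0 v (Set.Ici e) := by
  have h := gaussianReal_map_neg (μ := 0) (v := v)
  rw [neg_zero] at h
  conv_rhs => rw [← h]
  rw [Measure.map_apply (by fun_prop) measurableSet_Ici]
  congr 1
  ext x
  simp

/-- Otherwise the two symmetric tails would have total mass at least 1, leaving none for the
interval between them. -/
lemma gaussianReal_Ici_lt {v : NNReal} (hv : v ≠ 0) {e : ℝ} (he : 0 < e) :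
    gaussianReal 0 v (Set.Ici e) < 1 / 2 := by
  by_contra hcon
  push Not at hcon
  have h1 : gaussianReal 0 v (Set.Iic (-e) ∪ Set.Ici e ∪ Set.Ioo (-e) e) ≤ 1 := prob_le_one
  rw [measure_union _ measurableSet_Ioo, measure_union _ measurableSet_Ici,
    gaussianReal_Iic_neg_eq_Ici] at h1
  · have h2 : gaussianReal 0 v (Set.Ioo (-e) e) ≠ 0 := by
      intro h
      have := gaussianReal_absolutelyContinuous' 0 hv h
      simp at this
      linarith
    have h3 : 1 + gaussianReal 0 v (Set.Ioo (-e) e) ≤ 1 := by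
      refine le_trans ?_ h1
      gcongr
      calc (1 : ENNReal) = 1 / 2 + 1 / 2 := (ENNReal.add_halves 1).symm
        _ ≤ _ := by gcongr
    have h4 := ENNReal.lt_add_right (a := 1) ENNReal.one_ne_top h2
    exact absurd h3 (not_le.2 h4)
  · rw [Set.disjoint_left]
    intro x hx hx'
    simp only [Set.mem_Iic, Set.mem_Ici] at hx hx'
    linarith
  · rw [Set.disjoint_left]
    rintro x (hx | hx) hx'
    · exact absurd hx'.1 (not_lt.2 hx)
    · exact absurd hx'.2 (not_lt.2 hx)

/-- Probability measures with an atom of mass at least `1/2` do not converge weakly to a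
nondegenerate centred Gaussian. -/
lemma not_tendsto_gaussianReal_of_atom {v : NNReal} (hv : v ≠ 0) {μ : ℕ → ProbabilityMeasure ℝ}
    {y : ℕ → ℝ} (hy : ∀ k, 1 / 2 ≤ (μ k : Measure ℝ) {y k}) {ν : ProbabilityMeasure ℝ}
    (hν : (ν : Measure ℝ) = gaussianReal 0 v) : ¬ Tendsto μ atTop (𝓝 ν) := by
  intro h
  obtain ⟨e, he, hlt⟩ := exists_gaussianReal_Icc_lt hv
  -- Portmanteau. The atoms may wander, but three closed sets of Gaussian mass below 1/2 cover the
  -- line, and eventually none of them can contain an atom of mass 1/2.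
  have hcl : ∀ F : Set ℝ, IsClosed F → gaussianReal 0 v F < 1 / 2 →
      ∀ᶠ k in atTop, (μ k : Measure ℝ) F < 1 / 2 := by
    intro F hF hlt
    have := ProbabilityMeasure.limsup_measure_closed_le_of_tendsto h hF
    rw [hν] at this
    exact eventually_lt_of_limsup_lt (this.trans_lt hlt)
  have h1 := hcl _ isClosed_Icc hlt
  have h2 := hcl _ isClosed_Ici (gaussianReal_Ici_lt hv he)
  have h3 := hcl (Set.Iic (-e)) isClosed_Iic
    (by rw [gaussianReal_Iic_neg_eq_Ici]; exact gaussianReal_Ici_lt hv he)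
  obtain ⟨k, hk1, hk2, hk3⟩ := (h1.and (h2.and h3)).exists
  have hmem : ∀ F : Set ℝ, (μ k : Measure ℝ) F < 1 / 2 → y k ∉ F := fun F hF hyF =>
    absurd ((hy k).trans (measure_mono (Set.singleton_subset_iff.2 hyF))) (not_le.2 hF)
  have hy1 := hmem _ hk1
  have hy2 := hmem _ hk2
  have hy3 := hmem _ hk3
  simp only [Set.mem_Icc, Set.mem_Ici, Set.mem_Iic, not_and_or, not_le] at hy1 hy2 hy3
  rcases hy1 with h | h <;> linarith

end Atoms

/-! ### Two-coordinate vectors and their two-valued conditional variance. -/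

section PairVector

variable {n : ℕ}

/-- The unit vector supported on two coordinates with equal entries. -/
noncomputable def pairVector (j k : Fin n) : EuclideanSpace ℝ (Fin n) :=
  WithLp.toLp 2 (Pi.single j (1 / √2) + Pi.single k (1 / √2))

lemma inv_sqrt_two_mul_self : (1 / √2) * (1 / √2) = (1 / 2 : ℝ) := by
  rw [div_mul_div_comm, Real.mul_self_sqrt (by norm_num)]
  norm_num

lemma norm_pairVector {j k : Fin n} (h : j ≠ k) : ‖pairVector j k‖ = 1 := by
  have h1 : ‖pairVector j k‖ ^ 2 = 1 := by
    rw [EuclideanSpace.norm_sq_eq]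
    have : ∀ i, ‖(pairVector j k) i‖ ^ 2 =
        (if i = j then (1 / 2 : ℝ) else 0) + if i = k then (1 / 2 : ℝ) else 0 := by
      intro i
      rw [Real.norm_eq_abs, sq_abs, sq]
      simp only [pairVector, Pi.add_apply, Pi.single_apply]
      split_ifs with h1 h2
      · exact absurd (h1.symm.trans h2) h
      · rw [add_zero, inv_sqrt_two_mul_self]; norm_num
      · rw [zero_add, inv_sqrt_two_mul_self]; norm_num
      · norm_num
    simp_rw [this, Finset.sum_add_distrib]
    simp only [Finset.sum_ite_eq', Finset.mem_univ, if_true]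
    norm_num
  nlinarith [norm_nonneg (pairVector j k)]

lemma le_linftyNorm_pairVector {j k : Fin n} (h : j ≠ k) :
    1 / √2 ≤ linftyNorm (pairVector j k) := by
  refine le_trans (le_of_eq ?_) (abs_apply_le_linftyNorm _ j)
  simp [pairVector, h, abs_of_nonneg]

lemma signedTransform_pairVector (H : Matrix (Fin n) (Fin n) ℝ) (ε : Fin n → Bool) (j k i : Fin n) :
    signedTransform H ε (pairVector j k) i =
      1 / √2 * (H i j * boolSign (ε j) + H i k * boolSign (ε k)) := by
  simp only [signedTransform, pairVector, Pi.add_apply, mul_add, add_mul, Finset.sum_add_distrib,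
    Pi.single_apply, mul_ite, ite_mul, mul_zero, zero_mul, Finset.sum_ite_eq', Finset.mem_univ,
    if_true]
  ring

lemma pairVector_dotProduct {j k p q : Fin n} (h : [j, k, p, q].Nodup) :
    pairVector j k ⬝ᵥ pairVector p q = 0 := by
  simp only [List.nodup_cons, List.mem_cons, List.not_mem_nil, or_false, not_or] at h
  obtain ⟨⟨-, h2, h3⟩, ⟨h4, h5⟩, -, -⟩ := h
  simp [pairVector, Ne.symm h2, Ne.symm h3, Ne.symm h4, Ne.symm h5]

/-- Each squared coordinate is 1/n plus a product of two columns; the linear terms sum to zero by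
orthogonality, and the four-column product is constant. -/
lemma IsNormalizedHadamard.conditionalVariance_pairVector {H : Matrix (Fin n) (Fin n) ℝ}
    (hH : IsNormalizedHadamard H) {j k p q : Fin n} (hnd : [j, k, p, q].Nodup)
    (hprod : ∀ i, H i j * H i k * H i p * H i q = 1 / (n : ℝ) ^ 2) (ε : Fin n → Bool) :
    conditionalVariance H (pairVector j k) (pairVector p q) ε =
      1 + boolSign (ε j) * boolSign (ε k) * boolSign (ε p) * boolSign (ε q) := by
  have hn : (n : ℝ) ≠ 0 := by
    have : 0 < n := j.pos
    positivity
  simp only [List.nodup_cons, List.mem_cons, List.not_mem_nil, or_false, not_or] at hnd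
  obtain ⟨⟨hjk, -, -⟩, -, hpq, -⟩ := hnd
  have hsq := hH.sq_apply
  rw [Fintype.card_fin] at hsq
  have hu : ∀ x y i, signedTransform H ε (pairVector x y) i ^ 2 =
      1 / n + H i x * H i y * (boolSign (ε x) * boolSign (ε y)) := by
    intro x y i
    rw [signedTransform_pairVector, mul_pow, sq (1 / √2), inv_sqrt_two_mul_self]
    calc _ = 1 / 2 * (H i x ^ 2 * boolSign (ε x) ^ 2 + H i y ^ 2 * boolSign (ε y) ^ 2) +
          H i x * H i y * (boolSign (ε x) * boolSign (ε y)) := by ring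
      _ = _ := by rw [hsq, hsq, boolSign_sq, boolSign_sq]; ring
  have hterm : ∀ i, signedTransform H ε (pairVector j k) i ^ 2 *
      signedTransform H ε (pairVector p q) i ^ 2 =
      1 / (n : ℝ) ^ 2 * (1 + boolSign (ε j) * boolSign (ε k) * boolSign (ε p) * boolSign (ε q)) +
      (H i j * H i k) * (1 / n * (boolSign (ε j) * boolSign (ε k))) +
      (H i p * H i q) * (1 / n * (boolSign (ε p) * boolSign (ε q))) := by
    intro i
    rw [hu, hu]
    linear_combination
      (boolSign (ε j) * boolSign (ε k) * boolSign (ε p) * boolSign (ε q)) * hprod i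
  rw [conditionalVariance]
  simp_rw [hterm, Finset.sum_add_distrib, ← Finset.sum_mul, hH.sum_col_mul_col, if_neg hjk,
    if_neg hpq]
  simp
  field_simp

variable {j k p q : Fin n}

lemma integral_quad_boolSign (hnd : [j, k, p, q].Nodup) :
    ∫ ε, boolSign (ε j) * boolSign (ε k) * boolSign (ε p) * boolSign (ε q) ∂signMeasure (Fin n) =
      0 := by
  have h := integral_prod_boolSign_mul {j, k, p, q} (∅ : Finset (Fin n))
  simp only [List.nodup_cons, List.mem_cons, List.not_mem_nil, or_false, not_or] at hnd
  obtain ⟨⟨h1, h2, h3⟩, ⟨h4, h5⟩, h6, -⟩ := hnd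
  rw [if_neg (by simp)] at h
  rw [← h]
  refine integral_congr_ae (.of_forall fun ε => ?_)
  simp only [Finset.prod_empty, mul_one]
  rw [Finset.prod_insert (by simp [h1, h2, h3]), Finset.prod_insert (by simp [h4, h5]),
    Finset.prod_pair h6]
  ring

lemma quad_boolSign_eq (ε : Fin n → Bool) (j k p q : Fin n) :
    boolSign (ε j) * boolSign (ε k) * boolSign (ε p) * boolSign (ε q) = 1 ∨
    boolSign (ε j) * boolSign (ε k) * boolSign (ε p) * boolSign (ε q) = -1 := by
  cases ε j <;> cases ε k <;> cases ε p <;> cases ε q <;> simp [boolSign]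

/-- Any function of a ±1 variable is affine in it, so only the average of its two values survives.
-/
lemma integral_exp_quad (hnd : [j, k, p, q].Nodup) (s : ℝ) :
    ∫ ε, Real.exp (-(s * (1 + boolSign (ε j) * boolSign (ε k) * boolSign (ε p) *
      boolSign (ε q)) / 2)) ∂signMeasure (Fin n) = (1 + Real.exp (-s)) / 2 := by
  have h : ∀ ε : Fin n → Bool, Real.exp (-(s * (1 + boolSign (ε j) * boolSign (ε k) *
      boolSign (ε p) * boolSign (ε q)) / 2)) = (1 + Real.exp (-s)) / 2 +
      (Real.exp (-s) - 1) / 2 *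
        (boolSign (ε j) * boolSign (ε k) * boolSign (ε p) * boolSign (ε q)) := by
    intro ε
    rcases quad_boolSign_eq ε j k p q with h | h <;> rw [h]
    · rw [show s * (1 + 1) / 2 = s by ring]; ring
    · simp; ring
  simp_rw [h]
  rw [integral_add .of_finite .of_finite, integral_const_mul, integral_quad_boolSign hnd]
  simp

lemma signMeasure_quad_neg (hnd : [j, k, p, q].Nodup) :
    signMeasure (Fin n) {ε | boolSign (ε j) * boolSign (ε k) * boolSign (ε p) * boolSign (ε q) =
      -1} = 1 / 2 := by
  set A : Set (Fin n → Bool) :=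
    {ε | boolSign (ε j) * boolSign (ε k) * boolSign (ε p) * boolSign (ε q) = -1} with hA
  have h1 : ∀ ε, A.indicator (1 : (Fin n → Bool) → ℝ) ε = 1 / 2 - 1 / 2 *
      (boolSign (ε j) * boolSign (ε k) * boolSign (ε p) * boolSign (ε q)) := by
    intro ε
    rcases quad_boolSign_eq ε j k p q with h | h
    · rw [Set.indicator_of_notMem (by simp only [hA, Set.mem_ofPred_eq, h]; norm_num), h]; norm_num
    · rw [Set.indicator_of_mem (by simp only [hA, Set.mem_ofPred_eq, h]), h]; norm_num
  have h2 : (signMeasure (Fin n)).real A = 1 / 2 := by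
    rw [← integral_indicator_one (Set.toFinite A).measurableSet]
    simp_rw [h1]
    rw [integral_sub .of_finite .of_finite, integral_const_mul, integral_quad_boolSign hnd]
    simp
  rw [← ENNReal.ofReal_toReal (measure_ne_top _ A)]
  rw [Measure.real] at h2
  rw [h2]
  simp

end PairVector

/-! ### The atom at zero, and existence of transforms. -/

section Counterexample

variable {Ω : Type*} [MeasurableSpace Ω] {P : Measure Ω}
  {l m : ℕ} {hm : m ≤ 2 ^ l} {S : Ω → Matrix (Fin (2 ^ l)) (Fin (2 ^ l)) ℝ}

/-- When the product of the four signs is -1 the conditional variance, a sum of squares, is zero;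
every u_i v_i then vanishes, whatever the selectors. -/
lemma IsSRHT.half_le_measure_sketchedForm_eq_zero (hS : IsSRHT P l m hm S)
    {j k p q : Fin (2 ^ l)} (hnd : [j, k, p, q].Nodup)
    (hprod : ∀ i, hadamardMatrix l i j * hadamardMatrix l i k * hadamardMatrix l i p *
      hadamardMatrix l i q = 1 / (2 ^ l) ^ 2) :
    1 / 2 ≤ P {ω | sketchedForm (S ω) (pairVector j k) (pairVector p q) = 0} := by
  have h1 := Measure.map_apply_of_aemeasurable
    (hS.aemeasurable_sketchedForm (pairVector j k) (pairVector p q)) (measurableSet_singleton 0)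
  rw [hS.map_sketchedForm, Measure.map_apply (by fun_prop) (measurableSet_singleton 0)] at h1
  change _ ≤ P ((fun ω => sketchedForm (S ω) (pairVector j k) (pairVector p q)) ⁻¹' {0})
  rw [← h1, ← signMeasure_quad_neg hnd]
  set A : Set (Fin (2 ^ l) → Bool) :=
    {ε | boolSign (ε j) * boolSign (ε k) * boolSign (ε p) * boolSign (ε q) = -1} with hA
  have h2 : (Set.univ : Set (Fin (2 ^ l) → Bool)) ×ˢ A ⊆
      booleanForm (hadamardMatrix l) ((2 ^ l : ℕ) / (m : ℝ)) (pairVector j k) (pairVector p q) ⁻¹'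
        {0} := by
    rintro ⟨s, ε⟩ ⟨-, hε⟩
    have hε' : boolSign (ε j) * boolSign (ε k) * boolSign (ε p) * boolSign (ε q) = -1 := hε
    have hV := (isNormalizedHadamard_hadamardMatrix l).conditionalVariance_pairVector hnd
      (by simpa using hprod) ε
    rw [hε', conditionalVariance, Fintype.card_fin, add_neg_cancel] at hV
    have hsum := (mul_eq_zero.1 hV).resolve_left (by positivity)
    rw [Finset.sum_eq_zero_iff_of_nonneg fun i _ => by positivity] at hsum
    rw [Set.mem_preimage, Set.mem_singleton_iff, booleanForm]
    rw [Finset.sum_eq_zero, mul_zero]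
    intro i hi
    have := hsum i hi
    rw [← mul_pow] at this
    rw [pow_eq_zero_iff (by norm_num)] at this
    rw [this, mul_zero]
  refine le_trans ?_ (measure_mono h2)
  rw [Measure.prod_prod, measure_univ, one_mul]

lemma exists_isSRHT (l m : ℕ) (hm : m ≤ 2 ^ l) :
    ∃ (Ω : Type) (_ : MeasurableSpace Ω) (P : Measure Ω) (_ : IsProbabilityMeasure P)
      (S : Ω → Matrix (Fin (2 ^ l)) (Fin (2 ^ l)) ℝ), IsSRHT P l m hm S := by
  let ι := Fin (2 ^ l)
  let μ : ι ⊕ ι → Measure Bool := Sum.elim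
    (fun _ => bernoulliMeasure true false (samplingProb m (2 ^ l) hm))
    (fun _ => bernoulliMeasure true false halfProb)
  have hμ : ∀ i, IsProbabilityMeasure (μ i) := by
    rintro (i | i) <;> simp only [μ, Sum.elim_inl, Sum.elim_inr] <;> infer_instance
  let X : ι ⊕ ι → Bool → ℝ := Sum.elim (fun _ => boolInd) (fun _ => boolSign)
  have hind := iIndepFun_pi (μ := μ) (X := X) fun i => (measurable_of_finite (X i)).aemeasurable
  have hlaw : ∀ i, HasLaw (fun ω : ι ⊕ ι → Bool => X i (ω i)) ((μ i).map (X i)) (Measure.pi μ) := by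
    intro i
    have h := measurePreserving_eval μ i
    have hX := measurable_of_finite (X i)
    refine ⟨(hX.comp (measurable_pi_apply i)).aemeasurable, ?_⟩
    conv_rhs => rw [← h.map_eq]
    rw [Measure.map_map hX h.measurable]
    rfl
  refine ⟨ι ⊕ ι → Bool, inferInstance, Measure.pi μ, inferInstance,
    fun ω => √((2 ^ l : ℕ) / (m : ℝ)) • (Matrix.diagonal (fun i => boolInd (ω (.inl i))) *
      hadamardMatrix l * Matrix.diagonal (fun i => boolSign (ω (.inr i)))),
    fun i ω => boolInd (ω (.inl i)), fun i ω => boolSign (ω (.inr i)), fun i => ?_, fun i => ?_,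
    ?_, fun ω => rfl⟩
  · have := hlaw (.inl i)
    simp only [μ, X, Sum.elim_inl, map_bernoulliMeasure] at this
    exact this
  · have := hlaw (.inr i)
    simp only [μ, X, Sum.elim_inr, map_bernoulliMeasure] at this
    exact this
  · convert hind using 1
    funext i
    cases i <;> rfl

end Counterexample

/-! ### Excluding Gaussian and point-mass limits. -/

section NotNormal

variable {Ω : ℕ → Type*} [∀ k, MeasurableSpace (Ω k)] {P : ∀ k, Measure (Ω k)}
  [∀ k, IsProbabilityMeasure (P k)]

/-- If `X` vanishes with probability at least `1/2` and its characteristic functions at `1` stay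
away from modulus one, then `X` is not asymptotically normal. -/
lemma not_asymptoticallyNormal {X : ∀ k, Ω k → ℝ}
    (hX : ∀ k, AEMeasurable (X k) (P k)) (h0 : ∀ k, 1 / 2 ≤ P k {ω | X k ω = 0}) {z : ℂ}
    (hz : Tendsto (fun k => charFun ((P k).map (X k)) 1) atTop (𝓝 z)) (hz1 : ‖z‖ ≠ 1) :
    ¬ AsymptoticallyNormal P X := by
  rintro (⟨c, s, hs, h⟩ | ⟨c, v, h⟩)
  · refine not_tendsto_gaussianReal_of_atom one_ne_zero (y := fun k => -c k / s k) (fun k => ?_)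
      ?_ h.tendsto
    · simp only [ProbabilityMeasure.coe_mk]
      rw [Measure.map_apply_of_aemeasurable (h.forall_aemeasurable k) (measurableSet_singleton _)]
      refine (h0 k).trans (measure_mono fun ω hω => ?_)
      have hω : X k ω = 0 := hω
      simp [hω]
    · simp only [ProbabilityMeasure.coe_mk, Measure.map_id]
  · rcases eq_or_ne v 0 with rfl | hv
    · have h1 := (ProbabilityMeasure.tendsto_iff_tendsto_charFun.1 h.tendsto) 1
      simp only [ProbabilityMeasure.coe_mk, Measure.map_id, charFun_gaussianReal] at h1
      -- Centring only multiplies the characteristic function by a phase, so a point-mass limit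
      -- would force modulus 1.
      have h2 : ∀ k, ‖charFun ((P k).map fun ω => X k ω - c k) 1‖ =
          ‖charFun ((P k).map (X k)) 1‖ := by
        intro k
        have : (P k).map (fun ω => X k ω - c k) = ((P k).map (X k)).map fun x => x + -c k := by
          rw [AEMeasurable.map_map_of_aemeasurable (by fun_prop) (hX k)]
          rfl
        rw [this, charFun_map_add_const, norm_mul, Complex.norm_exp_ofReal_mul_I, mul_one]
      have h3 := h1.norm
      simp_rw [h2] at h3
      refine hz1 (tendsto_nhds_unique hz.norm ?_)
      simpa using h3
    · refine not_tendsto_gaussianReal_of_atom hv (y := fun k => -c k) (fun k => ?_)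
        ?_ h.tendsto
      · simp only [ProbabilityMeasure.coe_mk]
        rw [Measure.map_apply_of_aemeasurable (h.forall_aemeasurable k) (measurableSet_singleton _)]
        refine (h0 k).trans (measure_mono fun ω hω => ?_)
        have hω : X k ω = 0 := hω
        simp [hω]
      · simp only [ProbabilityMeasure.coe_mk, Measure.map_id]

/-- The sketched form of suitable pair vectors is not asymptotically normal. -/
lemma SketchRegime.not_asymptoticallyNormal {l m : ℕ → ℕ}
    {S : ∀ k, Ω k → Matrix (Fin (2 ^ l k)) (Fin (2 ^ l k)) ℝ} (hreg : SketchRegime l m)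
    (hS : ∀ k, IsSRHT (P k) (l k) (m k) (hreg.le k) (S k)) {γ : ℝ} (hγ : γ < 1)
    (hlim : Tendsto (fun k => (m k : ℝ) / ((2 ^ l k : ℕ) : ℝ)) atTop (𝓝 γ))
    {j₁ j₂ j₃ j₄ : ∀ k, Fin (2 ^ l k)} (hnd : ∀ k, [j₁ k, j₂ k, j₃ k, j₄ k].Nodup)
    (hprod : ∀ k i, hadamardMatrix (l k) i (j₁ k) * hadamardMatrix (l k) i (j₂ k) *
      hadamardMatrix (l k) i (j₃ k) * hadamardMatrix (l k) i (j₄ k) = 1 / (2 ^ l k) ^ 2) :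
    ¬ AsymptoticallyNormal P (fun k ω => √(m k : ℝ) *
      sketchedForm (S k ω) (pairVector (j₁ k) (j₂ k)) (pairVector (j₃ k) (j₄ k))) := by
  have hmeas : ∀ k, AEMeasurable (fun ω => sketchedForm (S k ω) (pairVector (j₁ k) (j₂ k))
      (pairVector (j₃ k) (j₄ k))) (P k) := fun k => (hS k).aemeasurable_sketchedForm _ _
  have hne : ∀ k, j₁ k ≠ j₂ k ∧ j₃ k ≠ j₄ k := fun k => by
    have := hnd k
    simp only [List.nodup_cons, List.mem_cons, List.not_mem_nil, or_false, not_or] at this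
    exact ⟨this.1.1, this.2.2.1⟩
  have hle : ∀ k, 0 ≤ 1 - (m k : ℝ) / ((2 ^ l k : ℕ) : ℝ) := fun k => by
    rw [sub_nonneg]
    exact div_le_one_of_le₀ (by exact_mod_cast hreg.le k) (by positivity)
  -- Evaluating at √(1-γ) undoes the normalization by 1/√(1-γ), giving the characteristic function
  -- of √m times the form at 1.
  set T : ℕ → ℝ := fun k => √(1 - (m k : ℝ) / ((2 ^ l k : ℕ) : ℝ)) with hT
  have hT1 : ∀ k, |T k| ≤ 1 := fun k => by
    rw [hT, abs_of_nonneg (Real.sqrt_nonneg _), Real.sqrt_le_one]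
    have : (0 : ℝ) ≤ (m k : ℝ) / ((2 ^ l k : ℕ) : ℝ) := by positivity
    linarith
  have h1 := hreg.tendsto_norm_charFun_sub hS (fun k => norm_pairVector (hne k).1)
    (fun k => norm_pairVector (hne k).2) hT1
  have h2 : ∀ k, ∫ ε, ((Real.exp (-(T k ^ 2 * conditionalVariance (hadamardMatrix (l k))
      (pairVector (j₁ k) (j₂ k)) (pairVector (j₃ k) (j₄ k)) ε / 2)) : ℝ) : ℂ)
      ∂signMeasure (Fin (2 ^ l k)) =
      (((1 + Real.exp (-(1 - (m k : ℝ) / ((2 ^ l k : ℕ) : ℝ)))) / 2 : ℝ) : ℂ) := by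
    intro k
    rw [integral_complex_ofReal, ← integral_exp_quad (hnd k)]
    congr 1
    refine integral_congr_ae (.of_forall fun ε => ?_)
    simp only
    rw [(isNormalizedHadamard_hadamardMatrix (l k)).conditionalVariance_pairVector (hnd k)
      (by simpa using hprod k) ε, hT, Real.sq_sqrt (hle k)]
  have h3 : Tendsto (fun k => (((1 + Real.exp (-(1 - (m k : ℝ) / ((2 ^ l k : ℕ) : ℝ)))) / 2 : ℝ) :
      ℂ)) atTop (𝓝 (((1 + Real.exp (-(1 - γ))) / 2 : ℝ) : ℂ)) := by
    refine (Complex.continuous_ofReal.tendsto _).comp ?_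
    have : Continuous fun x : ℝ => (1 + Real.exp (-(1 - x))) / 2 := by fun_prop
    exact (this.tendsto γ).comp hlim
  simp_rw [h2] at h1
  have h4 := (tendsto_zero_iff_norm_tendsto_zero.2 h1).add h3
  simp only [sub_add_cancel, zero_add] at h4
  refine _root_.not_asymptoticallyNormal (fun k => by have := hmeas k; fun_prop) (fun k => ?_)
    (h4.congr' ?_) ?_
  · refine ((hS k).half_le_measure_sketchedForm_eq_zero (hnd k) (hprod k)).trans
      (measure_mono fun ω hω => ?_)
    have hω : sketchedForm (S k ω) (pairVector (j₁ k) (j₂ k)) (pairVector (j₃ k) (j₄ k)) = 0 := hω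
    change _ * _ = (0 : ℝ)
    rw [hω, mul_zero]
  · obtain ⟨δ, hδ, hδe⟩ := hreg.exists_delta
    filter_upwards [hδe] with k hk
    have hpos : 0 < 1 - (m k : ℝ) / ((2 ^ l k : ℕ) : ℝ) := hδ.trans_le hk
    have hTk : 0 < T k := Real.sqrt_pos.2 hpos
    have hm2 := hmeas k
    rw [← mul_one (T k), ← charFun_map_mul_comp (by fun_prop)]
    congr 2
    funext ω
    rw [pairVector_dotProduct (hnd k), sub_zero, ← mul_assoc, Real.sqrt_div (by positivity)]
    congr 1
    exact mul_div_cancel₀ _ hTk.ne'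
  · rw [Complex.norm_real, Real.norm_of_nonneg (by positivity)]
    have : Real.exp (-(1 - γ)) < 1 := by rw [Real.exp_lt_one_iff]; linarith
    linarith

end NotNormal

/-! ### Choice of dimensions and sketch sizes. -/

section Sequences

lemma tendsto_two_pow_div_sq : Tendsto (fun k : ℕ => (2 : ℝ) ^ k / (k : ℝ) ^ 2) atTop atTop := by
  have h := tendsto_pow_const_div_const_pow_of_one_lt 2 (r := 2) (by norm_num)
  have h2 : Tendsto (fun k : ℕ => (k : ℝ) ^ 2 / (2 : ℝ) ^ k) atTop (𝓝[>] 0) := by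
    refine tendsto_nhdsWithin_iff.2 ⟨h, ?_⟩
    filter_upwards [eventually_gt_atTop 0] with k hk
    have : (0 : ℝ) < k := by exact_mod_cast hk
    exact Set.mem_Ioi.2 (by positivity)
  refine h2.inv_tendsto_nhdsGT_zero.congr fun k => ?_
  simp

/-- Dimensions with any prescribed limiting sampling ratio in `[0, 1)`. -/
lemma exists_sketchRegime {γ : ℝ} (h0 : 0 ≤ γ) (h1 : γ < 1) :
    ∃ l m : ℕ → ℕ, SketchRegime l m ∧ (∀ k, 2 ≤ l k) ∧
      Tendsto (fun k => (m k : ℝ) / ((2 ^ l k : ℕ) : ℝ)) atTop (𝓝 γ) := by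
  have h1' : 0 < 1 - γ := by linarith
  -- With n = 4^(k+1), the term of order √n makes m / log² n diverge even for γ = 0 and is
  -- negligible against n; the weight 1-γ keeps m ≤ n.
  let x : ℕ → ℝ := fun k => γ * 2 ^ (2 * k + 2) + (1 - γ) * 2 ^ k
  have hx0 : ∀ k, 0 ≤ x k := fun k => by positivity
  have hxlt : ∀ k, x k - 1 < ⌊x k⌋₊ := fun k => Nat.sub_one_lt_floor _
  have hxle : ∀ k, (⌊x k⌋₊ : ℝ) ≤ x k := fun k => Nat.floor_le (hx0 k)
  have hlim : Tendsto (fun k => (⌊x k⌋₊ : ℝ) / ((2 ^ (2 * k + 2) : ℕ) : ℝ)) atTop (𝓝 γ) := by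
    have ha : Tendsto (fun k : ℕ => ((1 : ℝ) / 2) ^ k) atTop (𝓝 0) :=
      tendsto_pow_atTop_nhds_zero_of_lt_one (by norm_num) (by norm_num)
    have hb : Tendsto (fun k : ℕ => ((1 : ℝ) / 4) ^ k) atTop (𝓝 0) :=
      tendsto_pow_atTop_nhds_zero_of_lt_one (by norm_num) (by norm_num)
    have hu : Tendsto (fun k : ℕ => γ + (1 - γ) / 4 * (1 / 2) ^ k) atTop (𝓝 γ) := by
      simpa using (ha.const_mul ((1 - γ) / 4)).const_add γ
    have hl : Tendsto (fun k : ℕ => γ + (1 - γ) / 4 * (1 / 2) ^ k - 1 / 4 * (1 / 4) ^ k) atTop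
        (𝓝 γ) := by
      simpa only [mul_zero, sub_zero] using hu.sub (hb.const_mul (1 / 4))
    have hx : ∀ k, x k / ((2 ^ (2 * k + 2) : ℕ) : ℝ) = γ + (1 - γ) / 4 * (1 / 2) ^ k := by
      intro k
      simp only [x]
      push_cast
      rw [pow_add, pow_mul', sq ((2 : ℝ) ^ k), one_div, inv_pow]
      field_simp
      ring
    have hone : ∀ k, 1 / ((2 ^ (2 * k + 2) : ℕ) : ℝ) = 1 / 4 * (1 / 4) ^ k := by
      intro k
      push_cast
      rw [pow_add, pow_mul, _root_.one_div_pow]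
      norm_num
    refine tendsto_of_tendsto_of_tendsto_of_le_of_le hl hu (fun k => ?_) fun k => ?_
    · change _ - _ ≤ _
      rw [← hx, ← hone, ← sub_div]
      exact div_le_div_of_nonneg_right (hxlt k).le (by positivity)
    · change _ ≤ _ + _
      rw [← hx]
      exact div_le_div_of_nonneg_right (hxle k) (by positivity)
  refine ⟨fun k => 2 * k + 2, fun k => ⌊x k⌋₊, ⟨fun k => ?_, ?_, ?_, ?_⟩, fun k => Nat.le_add_left 2 _, hlim⟩
  · refine Nat.floor_le_of_le ?_
    have : (2 : ℝ) ^ k ≤ 2 ^ (2 * k + 2) := pow_le_pow_right₀ (by norm_num) (by omega)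
    simp only [x]
    push_cast
    nlinarith
  · exact (tendsto_pow_atTop_atTop_of_one_lt (by norm_num)).comp
      (tendsto_atTop_mono (fun k => by simp only [id]; omega) tendsto_id)
  · have hlow : Tendsto (fun k : ℕ => (1 - γ) / 16 * ((2 : ℝ) ^ k / (k : ℝ) ^ 2) - 1 / 16) atTop
        atTop :=
      tendsto_atTop_add_const_right _ _ (tendsto_two_pow_div_sq.const_mul_atTop (by positivity))
    refine tendsto_atTop_mono' _ ?_ hlow
    filter_upwards [eventually_ge_atTop 1] with k hk
    have hk1 : (1 : ℝ) ≤ k := by exact_mod_cast hk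
    have hlog : Real.log ((2 ^ (2 * k + 2) : ℕ) : ℝ) ≤ 4 * k := by
      push_cast
      rw [Real.log_pow]
      push_cast
      have := Real.log_two_lt_d9
      nlinarith [Real.log_pos (by norm_num : (1 : ℝ) < 2)]
    have hlog0 : 0 < Real.log ((2 ^ (2 * k + 2) : ℕ) : ℝ) :=
      Real.log_pos (by exact_mod_cast Nat.one_lt_two_pow (by omega))
    have hge : (1 - γ) * 2 ^ k - 1 ≤ (⌊x k⌋₊ : ℝ) := by
      have := hxlt k
      have h3 : 0 ≤ γ * 2 ^ (2 * k + 2) := by positivity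
      simp only [x] at this ⊢
      linarith
    calc (1 - γ) / 16 * ((2 : ℝ) ^ k / (k : ℝ) ^ 2) - 1 / 16
        ≤ (1 - γ) / 16 * ((2 : ℝ) ^ k / (k : ℝ) ^ 2) - 1 / 16 * (1 / (k : ℝ) ^ 2) := by
          have : 1 / (k : ℝ) ^ 2 ≤ 1 := by
            rw [div_le_one (by positivity)]
            exact one_le_pow₀ hk1
          linarith
      _ = ((1 - γ) * 2 ^ k - 1) / (4 * k) ^ 2 := by
          field_simp
          ring
      _ ≤ (⌊x k⌋₊ : ℝ) / (4 * k) ^ 2 := by gcongr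
      _ ≤ _ := by gcongr
  · rw [hlim.limsup_eq]
    exact h1

end Sequences

theorem mainTheorem3 :
    -- the central limit theorem under delocalization
    (∀ (l m : ℕ → ℕ) (hreg : SketchRegime l m)
      (a a' : ∀ k, EuclideanSpace ℝ (Fin (2 ^ l k))),
      (∀ k, ‖a k‖ = 1) → (∀ k, ‖a' k‖ = 1) → Delocalized a a' →
      ∀ (Ω : ℕ → Type u) [∀ k, MeasurableSpace (Ω k)]
        (P : ∀ k, Measure (Ω k)) [∀ k, IsProbabilityMeasure (P k)]
        (S : ∀ k, Ω k → Matrix (Fin (2 ^ l k)) (Fin (2 ^ l k)) ℝ),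
        (∀ k, IsSRHT (P k) (l k) (m k) (hreg.le k) (S k)) →
        TendstoInDistribution
          (fun k ω =>
            √((m k : ℝ) / (1 - (m k : ℝ) / ((2 ^ l k : ℕ) : ℝ))) *
              √(1 / (1 + 2 * (a k ⬝ᵥ a' k) ^ 2)) *
              (sketchedForm (S k ω) (a k) (a' k) - a k ⬝ᵥ a' k))
          atTop id P (gaussianReal 0 1)) ∧
    -- normality can fail without delocalization, even if `m / n` converges
    (∀ γ : ℝ, 0 ≤ γ → γ < 1 →
      ∃ (l m : ℕ → ℕ) (hreg : SketchRegime l m)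
        (a a' : ∀ k, EuclideanSpace ℝ (Fin (2 ^ l k))),
        Tendsto (fun k => (m k : ℝ) / ((2 ^ l k : ℕ) : ℝ)) atTop (𝓝 γ) ∧
        (∀ k, ‖a k‖ = 1) ∧ (∀ k, ‖a' k‖ = 1) ∧ ¬ Delocalized a a' ∧
        ∃ (Ω : ℕ → Type) (_ : ∀ k, MeasurableSpace (Ω k))
          (P : ∀ k, Measure (Ω k)) (_ : ∀ k, IsProbabilityMeasure (P k))
          (S : ∀ k, Ω k → Matrix (Fin (2 ^ l k)) (Fin (2 ^ l k)) ℝ),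
          (∀ k, IsSRHT (P k) (l k) (m k) (hreg.le k) (S k)) ∧
          ¬ AsymptoticallyNormal P (fun k ω => √(m k : ℝ) * sketchedForm (S k ω) (a k) (a' k))) := by
  refine ⟨fun l m hreg a a' ha ha' hdeloc Ω _ P _ S hS =>
    hreg.tendstoInDistribution hS ha ha' hdeloc, fun γ h0 h1 => ?_⟩
  obtain ⟨l, m, hreg, hl, hlim⟩ := exists_sketchRegime h0 h1
  choose j₁ j₂ j₃ j₄ hnd hprod using fun k => exists_hadamardMatrix_quadruple (hl k)
  have hne : ∀ k, j₁ k ≠ j₂ k ∧ j₃ k ≠ j₄ k := fun k => by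
    have := hnd k
    simp only [List.nodup_cons, List.mem_cons, List.not_mem_nil, or_false, not_or] at this
    exact ⟨this.1.1, this.2.2.1⟩
  choose Ω mΩ P hP S hS using fun k => exists_isSRHT (l k) (m k) (hreg.le k)
  refine ⟨l, m, hreg, fun k => pairVector (j₁ k) (j₂ k), fun k => pairVector (j₃ k) (j₄ k), hlim,
    fun k => norm_pairVector (hne k).1, fun k => norm_pairVector (hne k).2, ?_,
    Ω, mΩ, P, hP, S, hS, hreg.not_asymptoticallyNormal hS h1 hlim hnd hprod⟩
  have hpos : 0 < 1 / √2 := by positivity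
  rintro (h | h)
  · exact absurd (ge_of_tendsto' h fun k => le_linftyNorm_pairVector (hne k).1) (not_le.2 hpos)
  · exact absurd (ge_of_tendsto' h fun k => le_linftyNorm_pairVector (hne k).2) (not_le.2 hpos)
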